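/- Let $a>b>c>0$ and let $\mathbb E=\{x^2/a^2+y^2/b^2+z^2/c^2=1\}\subset\mathbb R^3$, oriented by its inward unit normal. A geometric mean curvature line is a regular $C^1$ curve on $\mathbb E$, contained in the complement of the umbilic points, whose normal curvature at each point equals $\sqrt{\mathcal K}$, where $\mathcal K$ is the Gaussian curvature; lines are understood to be maximally extended and parametrized by arclength. A line is closed if it is a periodic curve; it is recurrent if it is contained in its limit set at one of its two ends at least (in its $\omega$-limit set or in its $\alpha$-limit set); it is an umbilic separatrix if it tends to an umbilic point at one of its ends at least. The four umbilic points $p_1=(x_0,0,z_0)$, $p_2=(-x_0,0,z_0)$, $p_3=(-x_0,0,-z_0)$, $p_4=(x_0,0,-z_0)$, with $x_0,z_0>0$, lie on the ellipse $\Sigma=\mathbb E\cap\{y=0\}$. With $h(w)=(w+a^2)(w+b^2)(w+c^2)$, measure distances along $\Sigma$ by the length element $d\sigma=\dfrac{\sqrt[4]{-w}}{\sqrt{|h(w)|}}\,|dw|$, where $w$ is the ellipsoidal coordinate that varies along the arc of $\Sigma$ in question (the other one being constant, equal to $-b^2$). Up to a common factor $2$, the distance between the adjacent umbilics $p_1$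 and $p_4$, and that between $p_1$ and $p_2$, are $$S_1=\int_{-b^2}^{-c^2}\frac{\sqrt[4]{-w}}{\sqrt{|h(w)|}}\,dw,\qquad S_2=\int_{-a^2}^{-b^2}\frac{\sqrt[4]{-w}}{\sqrt{|h(w)|}}\,dw .$$ Let $\rho=S_2/S_1$. (i) If $\rho$ is irrational, then every geometric mean curvature line of $\mathbb E$ is recurrent and not closed, and every line that is not an umbilic separatrix is contained both in its $\omega$-limit set and in its $\alpha$-limit set. (ii) If $\rho$ is rational, then a geometric mean curvature line of $\mathbb E$ is closed if and only if it is not an umbilic separatrix. -/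

import Mathlib

noncomputable section

namespace GeomMean

open Set Filter Topology

/-- Euclidean three-space. -/
abbrev E3 := EuclideanSpace ℝ (Fin 3)

/-! ### Curvature of a surface oriented by a unit normal field

`N` is a smooth unit vector field on a neighbourhood of the surface, normal to the surface.
Only its restriction to the surface matters below, because `N` is differentiated in
tangent directions only. -/

/-- The tangent plane at `p`: the orthogonal complement of the normal. -/
def tangentPlane (N : E3 → E3) (p : E3) : Submodule ℝ E3 := (Submodule.span ℝ {N p})ᗮ

/-- The second fundamental form `II_p(v, w) = -⟨dN_p v, w⟩`. It equals `⟨N, D²α⟩` in any local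
parametrization `α` of the surface. -/
def secondFF (N : E3 → E3) (p v w : E3) : ℝ := -inner ℝ (fderiv ℝ N p v) w

/-- The normal curvature in the direction of `v`, the quotient `II(v, v) / I(v, v)`. -/
def normalCurvature (N : E3 → E3) (p v : E3) : ℝ := secondFF N p v v / inner ℝ v v

/-- The shape operator `-dN_p` as an endomorphism of the tangent plane. (The values of `-dN_p` on
tangent vectors are tangent; the orthogonal projection serves only to type the operator.) -/
def shapeOperator (N : E3 → E3) (p : E3) : tangentPlane N p →ₗ[ℝ] tangentPlane N p :=
  (tangentPlane N p).orthogonalProjectionOnto.toLinearMap ∘ₗ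
    (-(fderiv ℝ N p)).toLinearMap ∘ₗ (tangentPlane N p).subtype

/-- The Gaussian curvature: the determinant of the shape operator. -/
def gaussCurvature (N : E3 → E3) (p : E3) : ℝ := LinearMap.det (shapeOperator N p)

/-- `p` is an umbilic point of the surface `S`: the two principal curvatures coincide at `p`. -/
def IsUmbilic (S : Set E3) (N : E3 → E3) (p : E3) : Prop :=
  p ∈ S ∧ ∃ k : ℝ, ∀ v ∈ tangentPlane N p, secondFF N p v v = k * inner ℝ v v

/-! ### Geometric mean curvature lines -/

/-- `γ`, restricted to the nonempty open interval `J`, is a geometric mean curvature line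
parametrized by arclength: a regular `C¹` curve in the complement of the umbilic points of the
elliptic region `K > 0` of `S`, whose normal curvature is `√K` everywhere. Since the two directions
of normal curvature `√K` are distinct at such points and depend continuously on the point, such a
curve stays in one of the two geometric mean curvature foliations. -/
structure IsGMCLine (S : Set E3) (N : E3 → E3) (J : Set ℝ) (γ : ℝ → E3) : Prop where
  isOpen : IsOpen J
  nonempty : J.Nonempty
  ordConnected : J.OrdConnected
  contDiffOn : ContDiffOn ℝ 1 γ J
  unitSpeed : ∀ t ∈ J, ‖deriv γ t‖ = 1
  mem : ∀ t ∈ J, γ t ∈ S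
  elliptic : ∀ t ∈ J, 0 < gaussCurvature N (γ t)
  not_umbilic : ∀ t ∈ J, ¬ IsUmbilic S N (γ t)
  normalCurvature_eq :
    ∀ t ∈ J, normalCurvature N (γ t) (deriv γ t) = Real.sqrt (gaussCurvature N (γ t))

/-- A complete (that is, maximally extended) geometric mean curvature line: a leaf of one of the
two foliations, parametrized by arclength. -/
structure IsCompleteGMCLine (S : Set E3) (N : E3 → E3) (J : Set ℝ) (γ : ℝ → E3) : Prop where
  isLine : IsGMCLine S N J γ
  maximal : ∀ (J' : Set ℝ) (γ' : ℝ → E3),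
    IsGMCLine S N J' γ' → J ⊆ J' → EqOn γ γ' J → J' = J

/-- The line is closed: it is a periodic curve. -/
def IsClosedLine (J : Set ℝ) (γ : ℝ → E3) : Prop :=
  J = univ ∧ ∃ T : ℝ, 0 < T ∧ Function.Periodic γ T

/-- The limit set of the line at its upper end. -/
def omegaLimitSet (J : Set ℝ) (γ : ℝ → E3) : Set E3 :=
  {x | MapClusterPt x atTop (fun t : J => γ t)}

/-- The limit set of the line at its lower end. -/
def alphaLimitSet (J : Set ℝ) (γ : ℝ → E3) : Set E3 :=
  {x | MapClusterPt x atBot (fun t : J => γ t)}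

/-- The line is contained in its limit set at the upper end. -/
def IsOmegaRecurrent (J : Set ℝ) (γ : ℝ → E3) : Prop := γ '' J ⊆ omegaLimitSet J γ

/-- The line is contained in its limit set at the lower end. -/
def IsAlphaRecurrent (J : Set ℝ) (γ : ℝ → E3) : Prop := γ '' J ⊆ alphaLimitSet J γ

/-- The line is recurrent: it is contained in its limit set at one end at least. -/
def IsRecurrent (J : Set ℝ) (γ : ℝ → E3) : Prop :=
  IsOmegaRecurrent J γ ∨ IsAlphaRecurrent J γ

/-- The line tends to an umbilic point at one end at least. Every umbilic point of a triaxial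
ellipsoid has, for each foliation, a single sector, which is hyperbolic, so that these lines are
exactly the umbilic separatrices. -/
def IsUmbilicSeparatrix (S : Set E3) (N : E3 → E3) (J : Set ℝ) (γ : ℝ → E3) : Prop :=
  ∃ p : E3, IsUmbilic S N p ∧
    (Tendsto (fun t : J => γ t) atTop (𝓝 p) ∨ Tendsto (fun t : J => γ t) atBot (𝓝 p))

/-! ### The ellipsoid -/

/-- The ellipsoid with semi-axes `a`, `b`, `c`. -/
def ellipsoid (a b c : ℝ) : Set E3 :=
  {p | p 0 ^ 2 / a ^ 2 + p 1 ^ 2 / b ^ 2 + p 2 ^ 2 / c ^ 2 = 1}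

/-- Half the gradient of the quadratic form that defines the ellipsoid. -/
def halfGradient (a b c : ℝ) (p : E3) : E3 := !₂[p 0 / a ^ 2, p 1 / b ^ 2, p 2 / c ^ 2]

/-- The inward unit normal, for which the normal curvatures of the ellipsoid are positive. -/
def inwardNormal (a b c : ℝ) (p : E3) : E3 :=
  -(‖halfGradient a b c p‖⁻¹ • halfGradient a b c p)

/-- The cubic of the confocal family. -/
def h (a b c w : ℝ) : ℝ := (w + a ^ 2) * (w + b ^ 2) * (w + c ^ 2)

/-- The length density `dσ/dw` in an ellipsoidal coordinate `w`. In the ellipsoidal coordinates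
`(u, v)` the geometric mean curvature lines are the curves `dσ(u)² = dσ(v)²`. -/
def sigmaDensity (a b c w : ℝ) : ℝ := (-w) ^ (1 / 4 : ℝ) / Real.sqrt |h a b c w|

/-- The `σ`-distance on the ellipse `y = 0` between the umbilic points `(x₀, 0, z₀)` and
`(x₀, 0, -z₀)`, up to the factor 2: on the arc between them through `(a, 0, 0)` the ellipsoidal
coordinate runs from `-b²` to `-c²` and back. -/
def S₁ (a b c : ℝ) : ℝ := ∫ w in (-b ^ 2)..(-c ^ 2), sigmaDensity a b c w

/-- The `σ`-distance on the ellipse `y = 0` between the umbilic points `(x₀, 0, z₀)` and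
`(-x₀, 0, z₀)`, up to the same factor 2: on the arc between them through `(0, 0, c)` the
ellipsoidal coordinate runs from `-b²` to `-a²` and back. -/
def S₂ (a b c : ℝ) : ℝ := ∫ w in (-a ^ 2)..(-b ^ 2), sigmaDensity a b c w

/-- The ratio of the two distances. -/
def rho (a b c : ℝ) : ℝ := S₂ a b c / S₁ a b c

end GeomMean

end

noncomputable section

namespace GeomMean

open Set Filter Topology MeasureTheory

/-! ### The arclength of `σ` in an angular coordinate -/

/-! The proof flattens the foliations on a torus. Replacing the ellipsoidal coordinates by angles,
`-u = quad (b²) (c²) φ` and `-v = quad (b²) (a²) ψ`, turns the singular length element `dσ` into a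
smooth positive periodic density `arcDensity`, and gives a doubly periodic parametrization `param`
of the whole ellipsoid, branched exactly at the umbilic points. In these angles both fundamental
forms are diagonal, and the equation "normal curvature equals `√K`" becomes `dσ(v)² = dσ(u)²`
(`normalCurvature_eq_iff`). So in the plane with coordinates `σ(u)`, `σ(v)` the geometric mean
curvature lines are the straight lines `σ(v) = ε σ(u) + d` with `ε = ±1`. Full turns of the angles
are translations by `4 S₁` and `4 S₂`, and the umbilic points are the lattice points `(2n S₁, 2m
S₂)`.

Each straight line has an arclength parametrization `path`, defined on all of `ℝ` and running
through any umbilic points it meets. Every geometric mean curvature line is a piece of some `path`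
(`exists_path_of_line`), and a complete one can only end in finite time at an umbilic point
(`exists_path_of_completeLine`). Hence a line that is not a separatrix is defined for all times.

What remains is arithmetic of `S₂ / S₁`. Dirichlet approximation brings `path` back near each of its
points in both time directions, whatever the ratio (`exists_path_mem`), so an infinite end is always
recurrent. For an irrational ratio a line meets at most one lattice point (`pathGap_unique`), so one
end is infinite; and it accumulates at an umbilic point (`umbilic_mem_closure_range_path`), which a
closed line, being compact and free of umbilic points, cannot do. For a rational ratio every `path`
is periodic (`exists_periodic_path`), so a line defined for all times is closed; conversely a
periodic curve that converges to a point passes through it, so closed lines are not separatrices. -/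

/-- The value `-w` of an ellipsoidal coordinate at the angle `x`. -/
def quad (B C x : ℝ) : ℝ := B * Real.cos x ^ 2 + C * Real.sin x ^ 2

/-- The length density `dσ/dx` in the angle `x`, where `w = -quad B C x`. -/
def arcDensity (B C D x : ℝ) : ℝ := 2 * quad B C x ^ (1 / 4 : ℝ) / Real.sqrt |quad B C x - D|

/-- The signed `σ`-length from the angle `0` to the angle `x`. -/
def arcLength (B C D x : ℝ) : ℝ := ∫ t in (0 : ℝ)..x, arcDensity B C D t

/-- The coordinate `-quad B C` stays negative and away from the root `-D`. -/
structure Nondegenerate (B C D : ℝ) : Prop where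
  pos : ∀ x, 0 < quad B C x
  ne : ∀ x, quad B C x ≠ D

lemma quad_add_pi (B C x : ℝ) : quad B C (x + Real.pi) = quad B C x := by
  simp [quad]

lemma quad_pi_sub (B C x : ℝ) : quad B C (Real.pi - x) = quad B C x := by
  simp [quad]

lemma continuous_quad (B C : ℝ) : Continuous (quad B C) := by
  unfold quad; fun_prop

lemma hasDerivAt_quad (B C x : ℝ) :
    HasDerivAt (quad B C) (-(2 * (B - C) * Real.sin x * Real.cos x)) x := by
  have h1 := ((Real.hasDerivAt_cos x).pow 2).const_mul B
  have h2 := ((Real.hasDerivAt_sin x).pow 2).const_mul C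
  exact (h1.add h2).congr_deriv (by push_cast; ring)

lemma quad_sub_left (B C x : ℝ) : quad B C x - B = (C - B) * Real.sin x ^ 2 := by
  have := Real.sin_sq_add_cos_sq x
  unfold quad; linear_combination B * this

lemma quad_sub_right (B C x : ℝ) : quad B C x - C = (B - C) * Real.cos x ^ 2 := by
  have := Real.sin_sq_add_cos_sq x
  unfold quad; linear_combination C * this

lemma arcDensity_add_pi (B C D x : ℝ) : arcDensity B C D (x + Real.pi) = arcDensity B C D x := by
  simp [arcDensity, quad_add_pi]

namespace Nondegenerate

variable {B C D : ℝ}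

lemma continuous_arcDensity (H : Nondegenerate B C D) : Continuous (arcDensity B C D) := by
  have hq := continuous_quad B C
  refine Continuous.div ?_ ?_ fun x => ?_
  · exact continuous_const.mul (hq.rpow_const fun x => Or.inl (H.pos x).ne')
  · exact Real.continuous_sqrt.comp (hq.sub continuous_const).abs
  · exact (Real.sqrt_pos.2 (abs_pos.2 (sub_ne_zero.2 (H.ne x)))).ne'

lemma arcDensity_pos (H : Nondegenerate B C D) (x : ℝ) : 0 < arcDensity B C D x := by
  have := H.pos x
  have := Real.sqrt_pos.2 (abs_pos.2 (sub_ne_zero.2 (H.ne x)))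
  unfold arcDensity; positivity

lemma arcDensity_sq (H : Nondegenerate B C D) (x : ℝ) :
    arcDensity B C D x ^ 2 = 4 * Real.sqrt (quad B C x) / |quad B C x - D| := by
  unfold arcDensity
  rw [div_pow, Real.sq_sqrt (abs_nonneg _), mul_pow, Real.sqrt_eq_rpow,
    ← Real.rpow_mul_natCast (H.pos x).le]
  norm_num

lemma intervalIntegrable (H : Nondegenerate B C D) (x y : ℝ) :
    IntervalIntegrable (arcDensity B C D) volume x y :=
  H.continuous_arcDensity.intervalIntegrable x y

lemma hasDerivAt_arcLength (H : Nondegenerate B C D) (x : ℝ) :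
    HasDerivAt (arcLength B C D) (arcDensity B C D x) x :=
  H.continuous_arcDensity.integral_hasStrictDerivAt 0 x |>.hasDerivAt

lemma strictMono_arcLength (H : Nondegenerate B C D) : StrictMono (arcLength B C D) :=
  strictMono_of_deriv_pos fun x => by
    rw [(H.hasDerivAt_arcLength x).deriv]; exact H.arcDensity_pos x

lemma continuous_arcLength (H : Nondegenerate B C D) : Continuous (arcLength B C D) :=
  continuous_iff_continuousAt.2 fun x => (H.hasDerivAt_arcLength x).continuousAt

lemma arcLength_zero : arcLength B C D 0 = 0 := by simp [arcLength]

lemma arcLength_pi_div_two_pos (H : Nondegenerate B C D) : 0 < arcLength B C D (Real.pi / 2) := by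
  rw [← arcLength_zero (B := B) (C := C) (D := D)]
  exact H.strictMono_arcLength (by positivity)

/-- The density has period `π` and is symmetric about `π / 2`, so each half turn contributes two
equal quarter turns. -/
lemma arcLength_add_pi (H : Nondegenerate B C D) (x : ℝ) :
    arcLength B C D (x + Real.pi) = arcLength B C D x + 2 * arcLength B C D (Real.pi / 2) := by
  have hper : Function.Periodic (arcDensity B C D) Real.pi := arcDensity_add_pi B C D
  have h1 : arcLength B C D (x + Real.pi) =
      arcLength B C D x + ∫ t in x..(x + Real.pi), arcDensity B C D t :=
    (intervalIntegral.integral_add_adjacent_intervals (H.intervalIntegrable _ _)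
      (H.intervalIntegrable _ _)).symm
  rw [h1, hper.intervalIntegral_add_eq x 0, zero_add, ← intervalIntegral.integral_add_adjacent_intervals
    (H.intervalIntegrable 0 (Real.pi / 2)) (H.intervalIntegrable _ _)]
  have h2 : ∫ t in (Real.pi / 2)..Real.pi, arcDensity B C D t =
      ∫ t in (0 : ℝ)..(Real.pi / 2), arcDensity B C D t := by
    have h3 := intervalIntegral.integral_comp_sub_left (arcDensity B C D) (a := 0) (b := Real.pi / 2)
      Real.pi
    rw [sub_zero, show Real.pi - Real.pi / 2 = Real.pi / 2 by ring] at h3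
    rw [← h3]
    congr 1; ext t; simp [arcDensity, quad_pi_sub]
  rw [h2]; unfold arcLength; ring

lemma arcLength_add_int_mul_pi (H : Nondegenerate B C D) (x : ℝ) (n : ℤ) :
    arcLength B C D (x + n * Real.pi) =
      arcLength B C D x + n * (2 * arcLength B C D (Real.pi / 2)) := by
  induction n using Int.induction_on with
  | zero => simp
  | succ n ih =>
    have := H.arcLength_add_pi (x + (n : ℤ) * Real.pi)
    push_cast at *
    rw [show x + (n + 1) * Real.pi = x + n * Real.pi + Real.pi by ring, this, ih]; ring
  | pred n ih =>
    have := H.arcLength_add_pi (x + (-(n : ℤ) - 1 : ℤ) * Real.pi)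
    push_cast at *
    rw [show x + (-(n : ℝ) - 1) * Real.pi + Real.pi = x + -(n : ℝ) * Real.pi by ring, ih] at this
    linarith

lemma arcLength_int_mul_pi (H : Nondegenerate B C D) (n : ℤ) :
    arcLength B C D (n * Real.pi) = n * (2 * arcLength B C D (Real.pi / 2)) := by
  simpa [arcLength_zero] using H.arcLength_add_int_mul_pi 0 n

lemma surjective_arcLength (H : Nondegenerate B C D) : Function.Surjective (arcLength B C D) := by
  have hS := H.arcLength_pi_div_two_pos
  refine H.continuous_arcLength.surjective
    (tendsto_atTop_atTop_of_monotone H.strictMono_arcLength.monotone fun y => ?_)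
    (tendsto_atBot_atBot_of_monotone H.strictMono_arcLength.monotone fun y => ?_)
  · obtain ⟨n, hn⟩ := exists_int_gt (y / (2 * arcLength B C D (Real.pi / 2)))
    refine ⟨n * Real.pi, ?_⟩
    rw [H.arcLength_int_mul_pi]
    exact ((div_lt_iff₀ (by positivity)).1 hn).le
  · obtain ⟨n, hn⟩ := exists_int_lt (y / (2 * arcLength B C D (Real.pi / 2)))
    refine ⟨n * Real.pi, ?_⟩
    rw [H.arcLength_int_mul_pi]
    exact ((lt_div_iff₀ (by positivity)).1 hn).le

/-- The arclength as an order isomorphism of the line. -/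
def arcIso (H : Nondegenerate B C D) : ℝ ≃o ℝ :=
  StrictMono.orderIsoOfSurjective _ H.strictMono_arcLength H.surjective_arcLength

@[simp] lemma arcIso_apply (H : Nondegenerate B C D) (x : ℝ) : H.arcIso x = arcLength B C D x := rfl

@[simp] lemma arcLength_arcIso_symm (H : Nondegenerate B C D) (x : ℝ) :
    arcLength B C D (H.arcIso.symm x) = x := H.arcIso.apply_symm_apply x

@[simp] lemma arcIso_symm_arcLength (H : Nondegenerate B C D) (x : ℝ) :
    H.arcIso.symm (arcLength B C D x) = x := H.arcIso.symm_apply_apply x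

lemma arcIso_symm_add (H : Nondegenerate B C D) (y : ℝ) (n : ℤ) :
    H.arcIso.symm (y + n * (2 * arcLength B C D (Real.pi / 2))) = H.arcIso.symm y + n * Real.pi := by
  rw [OrderIso.symm_apply_eq, arcIso_apply, H.arcLength_add_int_mul_pi, arcLength_arcIso_symm]

lemma continuous_arcIso_symm (H : Nondegenerate B C D) : Continuous H.arcIso.symm :=
  H.arcIso.symm.continuous

lemma hasDerivAt_arcIso_symm (H : Nondegenerate B C D) (y : ℝ) :
    HasDerivAt H.arcIso.symm (arcDensity B C D (H.arcIso.symm y))⁻¹ y :=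
  HasDerivAt.of_local_left_inverse H.continuous_arcIso_symm.continuousAt
    (H.hasDerivAt_arcLength _) (H.arcDensity_pos _).ne' (Eventually.of_forall (by simp))

end Nondegenerate

/-! ### The distances between the umbilic points -/

/-- Under `w = -quad B C x` the factors `(w + B)(w + C)` become minus the square of `(B - C) sin x
cos x`. Its root cancels against the Jacobian, which removes the endpoint singularities of `dσ`. -/
lemma abs_deriv_mul_density {B C D x : ℝ} (hBC : B ≠ C) (hx : x ∈ Ioo 0 (Real.pi / 2)) :
    |2 * (B - C) * Real.sin x * Real.cos x| * ((quad B C x) ^ (1 / 4 : ℝ) /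
      Real.sqrt |(-quad B C x + D) * (-quad B C x + B) * (-quad B C x + C)|) =
    arcDensity B C D x := by
  have hs : 0 < Real.sin x := Real.sin_pos_of_pos_of_lt_pi hx.1 (by linarith [hx.2, Real.pi_pos])
  have hc : 0 < Real.cos x := Real.cos_pos_of_mem_Ioo ⟨by linarith [hx.1, Real.pi_pos], hx.2⟩
  have hB := quad_sub_left B C x
  have hC := quad_sub_right B C x
  have h1 : (-quad B C x + D) * (-quad B C x + B) * (-quad B C x + C) =
      (quad B C x - D) * ((B - C) * Real.sin x * Real.cos x) ^ 2 := by
    rw [show -quad B C x + B = -(quad B C x - B) by ring,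
      show -quad B C x + C = -(quad B C x - C) by ring, hB, hC]; ring
  have h2 : |(B - C) * Real.sin x * Real.cos x| ≠ 0 := by
    simp [sub_ne_zero.2 hBC, hs.ne', hc.ne']
  rw [h1, abs_mul (quad B C x - D), Real.sqrt_mul (abs_nonneg _), abs_pow, Real.sqrt_sq (abs_nonneg _),
    show 2 * (B - C) * Real.sin x * Real.cos x = 2 * ((B - C) * Real.sin x * Real.cos x) by ring,
    abs_mul 2, abs_two]
  unfold arcDensity
  -- Nothing here keeps `quad B C x` away from `D`; where they agree, both sides are zero because
  -- division by zero is zero.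
  by_cases h3 : Real.sqrt |quad B C x - D| = 0
  · simp [h3]
  · field_simp

lemma integral_density_image {B C D : ℝ} (hBC : B ≠ C) :
    ∫ w in (fun x => -quad B C x) '' Ioo 0 (Real.pi / 2),
      (-w) ^ (1 / 4 : ℝ) / Real.sqrt |(w + D) * (w + B) * (w + C)| =
    arcLength B C D (Real.pi / 2) := by
  have hinj : InjOn (fun x => -quad B C x) (Ioo 0 (Real.pi / 2)) := by
    intro x hx y hy hxy
    have h1 := quad_sub_right B C x
    have h2 := quad_sub_right B C y
    have h3 : quad B C x = quad B C y := neg_injective hxy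
    have h4 : Real.cos x ^ 2 = Real.cos y ^ 2 := by
      have : (B - C) * Real.cos x ^ 2 = (B - C) * Real.cos y ^ 2 := by rw [← h1, ← h2, h3]
      exact mul_left_cancel₀ (sub_ne_zero.2 hBC) this
    have hcx : 0 < Real.cos x := Real.cos_pos_of_mem_Ioo ⟨by linarith [hx.1, Real.pi_pos], hx.2⟩
    have hcy : 0 < Real.cos y := Real.cos_pos_of_mem_Ioo ⟨by linarith [hy.1, Real.pi_pos], hy.2⟩
    have h5 : Real.cos x = Real.cos y := (pow_left_inj₀ hcx.le hcy.le two_ne_zero).1 h4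
    exact Real.injOn_cos ⟨hx.1.le, by linarith [hx.2, Real.pi_pos]⟩
      ⟨hy.1.le, by linarith [hy.2, Real.pi_pos]⟩ h5
  rw [integral_image_eq_integral_abs_deriv_smul measurableSet_Ioo
    (f' := fun x => 2 * (B - C) * Real.sin x * Real.cos x)
    (fun x _ => ((hasDerivAt_quad B C x).fun_neg.congr_deriv (neg_neg _)).hasDerivWithinAt) hinj]
  rw [arcLength, intervalIntegral.integral_of_le (by positivity), integral_Ioc_eq_integral_Ioo]
  refine setIntegral_congr_fun measurableSet_Ioo fun x hx => ?_
  simp only [smul_eq_mul, neg_neg]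
  exact abs_deriv_mul_density hBC hx

lemma quad_zero (B C : ℝ) : quad B C 0 = B := by simp [quad]

lemma quad_pi_div_two (B C : ℝ) : quad B C (Real.pi / 2) = C := by simp [quad]

lemma mem_Ioo_sq {x : ℝ} (hx : x ∈ Ioo 0 (Real.pi / 2)) :
    0 < Real.cos x ^ 2 ∧ 0 < Real.sin x ^ 2 :=
  ⟨pow_pos (Real.cos_pos_of_mem_Ioo ⟨by linarith [hx.1, Real.pi_pos], hx.2⟩) 2,
    pow_pos (Real.sin_pos_of_pos_of_lt_pi hx.1 (by linarith [hx.2, Real.pi_pos])) 2⟩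

lemma image_neg_quad_of_lt {B C : ℝ} (h : C < B) :
    (fun x => -quad B C x) '' Ioo 0 (Real.pi / 2) = Ioo (-B) (-C) := by
  apply Subset.antisymm
  · rintro _ ⟨x, hx, rfl⟩
    obtain ⟨h1, h2⟩ := mem_Ioo_sq hx
    have := quad_sub_left B C x
    have := quad_sub_right B C x
    constructor <;> nlinarith
  · have := intermediate_value_Ioo (a := 0) (b := Real.pi / 2) (by positivity)
      (f := fun x => -quad B C x) (continuous_quad B C).neg.continuousOn
    simpa [quad_zero, quad_pi_div_two] using this

lemma image_neg_quad_of_gt {B C : ℝ} (h : B < C) :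
    (fun x => -quad B C x) '' Ioo 0 (Real.pi / 2) = Ioo (-C) (-B) := by
  apply Subset.antisymm
  · rintro _ ⟨x, hx, rfl⟩
    obtain ⟨h1, h2⟩ := mem_Ioo_sq hx
    have := quad_sub_left B C x
    have := quad_sub_right B C x
    constructor <;> nlinarith
  · have := intermediate_value_Ioo' (a := 0) (b := Real.pi / 2) (by positivity)
      (f := fun x => -quad B C x) (continuous_quad B C).neg.continuousOn
    simpa [quad_zero, quad_pi_div_two] using this

/-- The semi-axes of a triaxial ellipsoid. -/
structure Triaxial (a b c : ℝ) : Prop where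
  hab : b < a
  hbc : c < b
  hc : 0 < c

namespace Triaxial

variable {a b c : ℝ}

lemma hb (H : Triaxial a b c) : 0 < b := H.hc.trans H.hbc
lemma ha (H : Triaxial a b c) : 0 < a := H.hb.trans H.hab
lemma sq_lt_left (H : Triaxial a b c) : b ^ 2 < a ^ 2 := pow_lt_pow_left₀ H.hab H.hb.le two_ne_zero
lemma sq_lt_right (H : Triaxial a b c) : c ^ 2 < b ^ 2 := pow_lt_pow_left₀ H.hbc H.hc.le two_ne_zero

lemma quad_bounds {B C m M : ℝ} (hB : B ∈ Icc m M) (hC : C ∈ Icc m M) (x : ℝ) :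
    quad B C x ∈ Icc m M := by
  have h1 := Real.sin_sq_add_cos_sq x
  have h2 := sq_nonneg (Real.sin x)
  have h3 := sq_nonneg (Real.cos x)
  unfold quad
  constructor
  · linear_combination mul_le_mul_of_nonneg_right hB.1 h3 +
      mul_le_mul_of_nonneg_right hC.1 h2 - m * h1
  · linear_combination mul_le_mul_of_nonneg_right hB.2 h3 +
      mul_le_mul_of_nonneg_right hC.2 h2 + M * h1

lemma mu_bounds (H : Triaxial a b c) (x : ℝ) : quad (b ^ 2) (c ^ 2) x ∈ Icc (c ^ 2) (b ^ 2) :=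
  quad_bounds ⟨H.sq_lt_right.le, le_rfl⟩ ⟨le_rfl, H.sq_lt_right.le⟩ x

lemma nu_bounds (H : Triaxial a b c) (x : ℝ) : quad (b ^ 2) (a ^ 2) x ∈ Icc (b ^ 2) (a ^ 2) :=
  quad_bounds ⟨le_rfl, H.sq_lt_left.le⟩ ⟨H.sq_lt_left.le, le_rfl⟩ x

lemma nondegU (H : Triaxial a b c) : Nondegenerate (b ^ 2) (c ^ 2) (a ^ 2) where
  pos x := (pow_pos H.hc 2).trans_le (H.mu_bounds x).1
  ne x := ((H.mu_bounds x).2.trans_lt H.sq_lt_left).ne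

lemma nondegV (H : Triaxial a b c) : Nondegenerate (b ^ 2) (a ^ 2) (c ^ 2) where
  pos x := (pow_pos H.hb 2).trans_le (H.nu_bounds x).1
  ne x := (H.sq_lt_right.trans_le (H.nu_bounds x).1).ne'

/-- The varying coordinate runs between the two roots `B` and `C` of the cubic, and `D` is the
remaining root. The common root `-b²` sits at angle `0`, which places the umbilic points at
multiples of `π`. -/
lemma S₁_eq (H : Triaxial a b c) :
    S₁ a b c = arcLength (b ^ 2) (c ^ 2) (a ^ 2) (Real.pi / 2) := by
  rw [← integral_density_image H.sq_lt_right.ne', image_neg_quad_of_lt H.sq_lt_right, S₁,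
    intervalIntegral.integral_of_le (by linarith [H.sq_lt_right]), integral_Ioc_eq_integral_Ioo]
  rfl

lemma S₂_eq (H : Triaxial a b c) :
    S₂ a b c = arcLength (b ^ 2) (a ^ 2) (c ^ 2) (Real.pi / 2) := by
  rw [← integral_density_image H.sq_lt_left.ne, image_neg_quad_of_gt H.sq_lt_left, S₂,
    intervalIntegral.integral_of_le (by linarith [H.sq_lt_left]), integral_Ioc_eq_integral_Ioo]
  refine setIntegral_congr_fun measurableSet_Ioo fun x _ => ?_
  simp only [sigmaDensity, h]
  congr 3; ring

lemma S₁_pos (H : Triaxial a b c) : 0 < S₁ a b c :=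
  H.S₁_eq ▸ H.nondegU.arcLength_pi_div_two_pos

lemma S₂_pos (H : Triaxial a b c) : 0 < S₂ a b c :=
  H.S₂_eq ▸ H.nondegV.arcLength_pi_div_two_pos

end Triaxial

/-! ### Coordinates of `E3` -/

lemma inner_eq (v w : E3) : inner ℝ v w = v 0 * w 0 + v 1 * w 1 + v 2 * w 2 := by
  simp [PiLp.inner_apply, Fin.sum_univ_three]; ring

lemma E3.ext {v w : E3} (h0 : v 0 = w 0) (h1 : v 1 = w 1) (h2 : v 2 = w 2) : v = w := by
  ext i; fin_cases i <;> assumption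

lemma hasDerivAt_E3 {γ : ℝ → E3} {γ' : E3} {t : ℝ} (h0 : HasDerivAt (fun t => γ t 0) (γ' 0) t)
    (h1 : HasDerivAt (fun t => γ t 1) (γ' 1) t) (h2 : HasDerivAt (fun t => γ t 2) (γ' 2) t) :
    HasDerivAt γ γ' t := by
  rw [hasDerivAt_iff_hasFDerivAt, ← hasFDerivWithinAt_univ, hasFDerivWithinAt_piLp]
  intro i
  rw [hasFDerivWithinAt_univ, hasFDerivAt_iff_hasDerivAt]
  fin_cases i <;> simpa

lemma inner_halfGradient (a b c : ℝ) (v w : E3) : inner ℝ (halfGradient a b c v) w =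
    v 0 * w 0 / a ^ 2 + v 1 * w 1 / b ^ 2 + v 2 * w 2 / c ^ 2 := by
  rw [inner_eq]; simp [halfGradient]; ring

lemma inner_halfGradient_comm (a b c : ℝ) (v w : E3) :
    inner ℝ (halfGradient a b c v) w = inner ℝ (halfGradient a b c w) v := by
  simp only [inner_halfGradient]; ring

lemma inner_halfGradient_self_of_mem {a b c : ℝ} {p : E3} (hp : p ∈ ellipsoid a b c) :
    inner ℝ (halfGradient a b c p) p = 1 := by
  rw [inner_halfGradient, ← hp]; ring

/-- `halfGradient` as a continuous linear map. -/
def halfGradientL (a b c : ℝ) : E3 →L[ℝ] E3 :=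
  LinearMap.toContinuousLinearMap
    { toFun := halfGradient a b c
      map_add' := fun v w => E3.ext (by simp [halfGradient]; ring) (by simp [halfGradient]; ring)
        (by simp [halfGradient]; ring)
      map_smul' := fun r v => E3.ext (by simp [halfGradient]; ring) (by simp [halfGradient]; ring)
        (by simp [halfGradient]; ring) }

lemma halfGradientL_apply (a b c : ℝ) (p : E3) : halfGradientL a b c p = halfGradient a b c p := rfl

/-! ### Curvature of the ellipsoid -/

section Curvature

variable {a b c : ℝ} {p : E3}

lemma mem_tangentPlane_iff (hp : halfGradient a b c p ≠ 0) (v : E3) :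
    v ∈ tangentPlane (inwardNormal a b c) p ↔ inner ℝ (halfGradient a b c p) v = 0 := by
  rw [tangentPlane, Submodule.mem_orthogonal_singleton_iff_inner_right, inwardNormal, inner_neg_left,
    inner_smul_left]
  simp [hp]

/-- Differentiating the normalizing factor only produces a multiple of `halfGradient a b c p`, which
is orthogonal to `w`; its derivative never has to be computed. -/
lemma inner_fderiv_inwardNormal (hp : halfGradient a b c p ≠ 0) (v : E3) {w : E3}
    (hw : inner ℝ (halfGradient a b c p) w = 0) :
    inner ℝ (fderiv ℝ (inwardNormal a b c) p v) w =
      -(‖halfGradient a b c p‖⁻¹ * inner ℝ (halfGradient a b c v) w) := by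
  have h1 : HasFDerivAt (halfGradient a b c) (halfGradientL a b c) p :=
    (halfGradientL a b c).hasFDerivAt
  have h2 : DifferentiableAt ℝ (fun q => ‖halfGradient a b c q‖⁻¹) p :=
    (h1.differentiableAt.norm ℝ hp).inv (norm_ne_zero_iff.2 hp)
  have h3 : HasFDerivAt (inwardNormal a b c) _ p := (h2.hasFDerivAt.smul h1).neg
  rw [h3.fderiv]
  simp [inner_add_left, inner_smul_left, hw, halfGradientL_apply]

lemma secondFF_eq (hp : halfGradient a b c p ≠ 0) (v : E3) {w : E3}
    (hw : inner ℝ (halfGradient a b c p) w = 0) :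
    secondFF (inwardNormal a b c) p v w =
      ‖halfGradient a b c p‖⁻¹ * inner ℝ (halfGradient a b c v) w := by
  rw [secondFF, inner_fderiv_inwardNormal hp v hw, neg_neg]

lemma finrank_tangentPlane (hp : halfGradient a b c p ≠ 0) :
    Module.finrank ℝ (tangentPlane (inwardNormal a b c) p) = 2 := by
  have : Fact (Module.finrank ℝ E3 = 2 + 1) := ⟨by simp⟩
  exact Submodule.finrank_orthogonal_span_singleton (by simp [inwardNormal, hp])

lemma inner_shapeOperator (hp : halfGradient a b c p ≠ 0)
    (v w : tangentPlane (inwardNormal a b c) p) :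
    inner ℝ (shapeOperator (inwardNormal a b c) p v) w =
      ‖halfGradient a b c p‖⁻¹ * inner ℝ (halfGradient a b c v) (w : E3) := by
  rw [← secondFF_eq hp _ ((mem_tangentPlane_iff hp _).1 w.2), secondFF]
  rw [← inner_neg_left]
  exact Submodule.inner_orthogonalProjectionOnto_eq_of_mem_right w _

end Curvature

/-! ### Linear algebra of an orthogonal pair in a plane -/

section OrthogonalPair

variable {V : Type*} [NormedAddCommGroup V] [InnerProductSpace ℝ V]

/-- Two nonzero orthogonal vectors in a plane form a basis. -/
lemma exists_basis_of_orthogonal (hV : Module.finrank ℝ V = 2) {e₁ e₂ : V} (h₁ : e₁ ≠ 0)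
    (h₂ : e₂ ≠ 0) (h₁₂ : inner ℝ e₁ e₂ = 0) :
    ∃ B : Module.Basis (Fin 2) ℝ V, B 0 = e₁ ∧ B 1 = e₂ := by
  have hli : LinearIndependent ℝ ![e₁, e₂] := by
    refine linearIndependent_of_ne_zero_of_inner_eq_zero (𝕜 := ℝ) ?_ ?_
    · intro i; fin_cases i <;> simpa
    · intro i j hij
      fin_cases i <;> fin_cases j <;> simp_all [real_inner_comm]
  exact ⟨basisOfLinearIndependentOfCardEqFinrank hli (by simp [hV]), by simp, by simp⟩

lemma eq_of_inner_eq_of_orthogonal (hV : Module.finrank ℝ V = 2) {e₁ e₂ : V} (h₁ : e₁ ≠ 0)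
    (h₂ : e₂ ≠ 0) (h₁₂ : inner ℝ e₁ e₂ = 0) {x y : V} (hx₁ : inner ℝ x e₁ = inner ℝ y e₁)
    (hx₂ : inner ℝ x e₂ = inner ℝ y e₂) : x = y := by
  obtain ⟨B, rfl, rfl⟩ := exists_basis_of_orthogonal hV h₁ h₂ h₁₂
  refine InnerProductSpace.ext_inner_right_basis (𝕜 := ℝ) B fun i => ?_
  fin_cases i <;> assumption

/-- The operator is known only through its inner products with the pair, as the shape operator is
through the second fundamental form; these products already force both vectors to be eigenvectors.
-/
lemma det_of_diagonal (hV : Module.finrank ℝ V = 2) {e₁ e₂ : V} (h₁ : e₁ ≠ 0) (h₂ : e₂ ≠ 0)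
    (h₁₂ : inner ℝ e₁ e₂ = 0) (T : V →ₗ[ℝ] V) {k₁ k₂ : ℝ}
    (h11 : inner ℝ (T e₁) e₁ = k₁ * inner ℝ e₁ e₁) (h12 : inner ℝ (T e₁) e₂ = 0)
    (h21 : inner ℝ (T e₂) e₁ = 0) (h22 : inner ℝ (T e₂) e₂ = k₂ * inner ℝ e₂ e₂) :
    LinearMap.det T = k₁ * k₂ := by
  have hT₁ : T e₁ = k₁ • e₁ := eq_of_inner_eq_of_orthogonal hV h₁ h₂ h₁₂
    (by rw [h11, inner_smul_left]; simp) (by rw [h12, inner_smul_left, h₁₂]; simp)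
  have hT₂ : T e₂ = k₂ • e₂ := eq_of_inner_eq_of_orthogonal hV h₁ h₂ h₁₂
    (by rw [h21, inner_smul_left, real_inner_comm, h₁₂]; simp) (by rw [h22, inner_smul_left]; simp)
  obtain ⟨B, rfl, rfl⟩ := exists_basis_of_orthogonal hV h₁ h₂ h₁₂
  rw [← LinearMap.det_toMatrix B, Matrix.det_fin_two]
  simp [LinearMap.toMatrix_apply, hT₁, hT₂]

end OrthogonalPair

/-! ### The parametrization by two angles -/

/-- The first radical that occurs in the parametrization. -/
def radU (a b c φ : ℝ) : ℝ := Real.sqrt (a ^ 2 - quad (b ^ 2) (c ^ 2) φ)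

/-- The second radical that occurs in the parametrization. -/
def radV (a b c ψ : ℝ) : ℝ := Real.sqrt (quad (b ^ 2) (a ^ 2) ψ - c ^ 2)

/-- The doubly periodic parametrization of the ellipsoid, a twofold covering branched at the
umbilic points, which are the values at the integer multiples of `π`. The ellipsoidal coordinates
are `u = -quad (b²) (c²) φ` and `v = -quad (b²) (a²) ψ`. -/
def param (a b c φ ψ : ℝ) : E3 :=
  !₂[a * Real.cos ψ * radU a b c φ / Real.sqrt (a ^ 2 - c ^ 2), b * Real.sin φ * Real.sin ψ,
    c * Real.cos φ * radV a b c ψ / Real.sqrt (a ^ 2 - c ^ 2)]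

/-- The partial derivative of `param` in `φ`. -/
def paramU (a b c φ ψ : ℝ) : E3 :=
  !₂[a * Real.cos ψ * ((b ^ 2 - c ^ 2) * Real.sin φ * Real.cos φ / radU a b c φ) /
      Real.sqrt (a ^ 2 - c ^ 2),
    b * Real.cos φ * Real.sin ψ,
    -(c * Real.sin φ * radV a b c ψ / Real.sqrt (a ^ 2 - c ^ 2))]

/-- The partial derivative of `param` in `ψ`. -/
def paramV (a b c φ ψ : ℝ) : E3 :=
  !₂[-(a * Real.sin ψ * radU a b c φ / Real.sqrt (a ^ 2 - c ^ 2)),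
    b * Real.sin φ * Real.cos ψ,
    c * Real.cos φ * ((a ^ 2 - b ^ 2) * Real.sin ψ * Real.cos ψ / radV a b c ψ) /
      Real.sqrt (a ^ 2 - c ^ 2)]

/-- The difference of the ellipsoidal coordinates, which vanishes at the umbilic points. -/
def gap (a b c φ ψ : ℝ) : ℝ := quad (b ^ 2) (a ^ 2) ψ - quad (b ^ 2) (c ^ 2) φ

/-! ### The two fundamental forms and the curvatures in the angles -/

namespace Triaxial

variable {a b c : ℝ} (H : Triaxial a b c)

include H

lemma radU_pos (φ : ℝ) : 0 < radU a b c φ :=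
  Real.sqrt_pos.2 (by linarith [(H.mu_bounds φ).2, H.sq_lt_left])

lemma radV_pos (ψ : ℝ) : 0 < radV a b c ψ :=
  Real.sqrt_pos.2 (by linarith [(H.nu_bounds ψ).1, H.sq_lt_right])

lemma sqrt_pos : 0 < Real.sqrt (a ^ 2 - c ^ 2) :=
  Real.sqrt_pos.2 (by linarith [H.sq_lt_left, H.sq_lt_right])

lemma radU_sq (φ : ℝ) : radU a b c φ ^ 2 = a ^ 2 - quad (b ^ 2) (c ^ 2) φ :=
  Real.sq_sqrt (by linarith [(H.mu_bounds φ).2, H.sq_lt_left])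

lemma radV_sq (ψ : ℝ) : radV a b c ψ ^ 2 = quad (b ^ 2) (a ^ 2) ψ - c ^ 2 :=
  Real.sq_sqrt (by linarith [(H.nu_bounds ψ).1, H.sq_lt_right])

lemma sqrt_sq : Real.sqrt (a ^ 2 - c ^ 2) ^ 2 = a ^ 2 - c ^ 2 :=
  Real.sq_sqrt (by linarith [H.sq_lt_left, H.sq_lt_right])

/-- After clearing denominators and eliminating the squared radicals and `sin²`, this is a
polynomial identity; the inner products below are computed in the same way. -/
lemma param_mem (φ ψ : ℝ) : param a b c φ ψ ∈ ellipsoid a b c := by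
  have := H.ha.ne'; have := H.hb.ne'; have := H.hc.ne'
  have := H.sqrt_pos.ne'
  simp only [ellipsoid, mem_ofPred_eq, param, Matrix.cons_val]
  field_simp
  simp only [H.radU_sq, H.radV_sq, H.sqrt_sq, quad, Real.sin_sq]
  ring

lemma inner_normal_paramU (φ ψ : ℝ) :
    inner ℝ (halfGradient a b c (param a b c φ ψ)) (paramU a b c φ ψ) = 0 := by
  have := H.ha.ne'; have := H.hb.ne'; have := H.hc.ne'
  have := H.sqrt_pos.ne'; have := (H.radU_pos φ).ne'
  simp only [inner_halfGradient, param, paramU, Matrix.cons_val]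
  field_simp
  simp only [H.radV_sq, H.sqrt_sq, quad, Real.sin_sq]
  ring

lemma inner_normal_paramV (φ ψ : ℝ) :
    inner ℝ (halfGradient a b c (param a b c φ ψ)) (paramV a b c φ ψ) = 0 := by
  have := H.ha.ne'; have := H.hb.ne'; have := H.hc.ne'
  have := H.sqrt_pos.ne'; have := (H.radV_pos ψ).ne'
  simp only [inner_halfGradient, param, paramV, Matrix.cons_val]
  field_simp
  simp only [H.radU_sq, H.sqrt_sq, quad, Real.sin_sq]
  ring

lemma inner_paramU_paramV (φ ψ : ℝ) : inner ℝ (paramU a b c φ ψ) (paramV a b c φ ψ) = 0 := by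
  have := H.sqrt_pos.ne'; have := (H.radU_pos φ).ne'; have := (H.radV_pos ψ).ne'
  simp only [inner_eq, paramU, paramV, Matrix.cons_val]
  field_simp
  simp only [H.sqrt_sq]
  ring

/-- Together with orthogonality this makes the coordinate curves lines of curvature. -/
lemma conjugate_paramU_paramV (φ ψ : ℝ) :
    inner ℝ (halfGradient a b c (paramU a b c φ ψ)) (paramV a b c φ ψ) = 0 := by
  have := H.ha.ne'; have := H.hb.ne'; have := H.hc.ne'
  have := H.sqrt_pos.ne'; have := (H.radU_pos φ).ne'; have := (H.radV_pos ψ).ne'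
  simp only [inner_halfGradient, paramU, paramV, Matrix.cons_val]
  field_simp
  simp only [H.sqrt_sq]
  ring

lemma inner_paramU_self (φ ψ : ℝ) : inner ℝ (paramU a b c φ ψ) (paramU a b c φ ψ) =
    quad (b ^ 2) (c ^ 2) φ * gap a b c φ ψ / radU a b c φ ^ 2 := by
  have := H.sqrt_pos.ne'; have := (H.radU_pos φ).ne'
  simp only [inner_eq, paramU, gap, Matrix.cons_val]
  field_simp
  simp only [H.radU_sq, H.radV_sq, H.sqrt_sq, quad, Real.sin_sq]
  ring

/-- This differs from `inner_paramU_self` by the factor `quad (b²) (c²) φ` alone, so the principal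
curvature is the inverse norm of the gradient divided by that factor. The same happens for `ψ`. -/
lemma conjugate_paramU_self (φ ψ : ℝ) :
    inner ℝ (halfGradient a b c (paramU a b c φ ψ)) (paramU a b c φ ψ) =
      gap a b c φ ψ / radU a b c φ ^ 2 := by
  have := H.ha.ne'; have := H.hb.ne'; have := H.hc.ne'
  have := H.sqrt_pos.ne'; have := (H.radU_pos φ).ne'
  simp only [inner_halfGradient, paramU, gap, Matrix.cons_val]
  field_simp
  simp only [H.radU_sq, H.radV_sq, H.sqrt_sq, quad, Real.sin_sq]
  ring

lemma inner_paramV_self (φ ψ : ℝ) : inner ℝ (paramV a b c φ ψ) (paramV a b c φ ψ) =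
    quad (b ^ 2) (a ^ 2) ψ * gap a b c φ ψ / radV a b c ψ ^ 2 := by
  have := H.sqrt_pos.ne'; have := (H.radV_pos ψ).ne'
  simp only [inner_eq, paramV, gap, Matrix.cons_val]
  field_simp
  simp only [H.radU_sq, H.radV_sq, H.sqrt_sq, quad, Real.sin_sq]
  ring

lemma conjugate_paramV_self (φ ψ : ℝ) :
    inner ℝ (halfGradient a b c (paramV a b c φ ψ)) (paramV a b c φ ψ) =
      gap a b c φ ψ / radV a b c ψ ^ 2 := by
  have := H.ha.ne'; have := H.hb.ne'; have := H.hc.ne'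
  have := H.sqrt_pos.ne'; have := (H.radV_pos ψ).ne'
  simp only [inner_halfGradient, paramV, gap, Matrix.cons_val]
  field_simp
  simp only [H.radU_sq, H.radV_sq, H.sqrt_sq, quad, Real.sin_sq]
  ring

omit H in
lemma gap_eq (φ ψ : ℝ) : gap a b c φ ψ =
    (a ^ 2 - b ^ 2) * Real.sin ψ ^ 2 + (b ^ 2 - c ^ 2) * Real.sin φ ^ 2 := by
  have h1 := quad_sub_left (b ^ 2) (a ^ 2) ψ
  have h2 := quad_sub_left (b ^ 2) (c ^ 2) φ
  unfold gap; linear_combination h1 - h2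

lemma gap_nonneg (φ ψ : ℝ) : 0 ≤ gap a b c φ ψ := by
  have h1 := sub_pos.2 H.sq_lt_left
  have h2 := sub_pos.2 H.sq_lt_right
  rw [gap_eq]; positivity

lemma gap_eq_zero_iff (φ ψ : ℝ) : gap a b c φ ψ = 0 ↔ Real.sin φ = 0 ∧ Real.sin ψ = 0 := by
  have h1 := sub_pos.2 H.sq_lt_left
  have h2 := sub_pos.2 H.sq_lt_right
  rw [gap_eq, add_eq_zero_iff_of_nonneg (by positivity) (by positivity)]
  simp [h1.ne', h2.ne', and_comm]

omit H in
lemma halfGradient_ne_zero {p : E3} (hp : p ∈ ellipsoid a b c) : halfGradient a b c p ≠ 0 := by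
  intro h0
  have := inner_halfGradient_self_of_mem hp
  simp [h0] at this

/-- The parametrization is regular where the ellipsoidal coordinates differ. -/
lemma exists_eq_add_smul {φ ψ : ℝ} (hg : gap a b c φ ψ ≠ 0) {v : E3}
    (hv : inner ℝ (halfGradient a b c (param a b c φ ψ)) v = 0) :
    ∃ α β : ℝ, v = α • paramU a b c φ ψ + β • paramV a b c φ ψ := by
  have hp := halfGradient_ne_zero (H.param_mem φ ψ)
  have hU := H.inner_paramU_self φ ψ
  have hV := H.inner_paramV_self φ ψ
  have hUV := H.inner_paramU_paramV φ ψ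
  have hU0 : inner ℝ (paramU a b c φ ψ) (paramU a b c φ ψ) ≠ 0 := by
    rw [hU]; exact div_ne_zero (mul_ne_zero (H.nondegU.pos φ).ne' hg) (pow_pos (H.radU_pos φ) 2).ne'
  have hV0 : inner ℝ (paramV a b c φ ψ) (paramV a b c φ ψ) ≠ 0 := by
    rw [hV]; exact div_ne_zero (mul_ne_zero (H.nondegV.pos ψ).ne' hg) (pow_pos (H.radV_pos ψ) 2).ne'
  let W := tangentPlane (inwardNormal a b c) (param a b c φ ψ)
  let e₁ : W := ⟨paramU a b c φ ψ, (mem_tangentPlane_iff hp _).2 (H.inner_normal_paramU φ ψ)⟩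
  let e₂ : W := ⟨paramV a b c φ ψ, (mem_tangentPlane_iff hp _).2 (H.inner_normal_paramV φ ψ)⟩
  let x : W := ⟨v, (mem_tangentPlane_iff hp _).2 hv⟩
  obtain ⟨B, h1, h2⟩ := exists_basis_of_orthogonal (finrank_tangentPlane hp) (e₁ := e₁) (e₂ := e₂)
    (fun h => hU0 (by simp [show paramU a b c φ ψ = 0 from congrArg Subtype.val h]))
    (fun h => hV0 (by simp [show paramV a b c φ ψ = 0 from congrArg Subtype.val h])) hUV
  refine ⟨B.repr x 0, B.repr x 1, ?_⟩
  have h3 := B.sum_repr x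
  rw [Fin.sum_univ_two, h1, h2] at h3
  exact (congrArg Subtype.val h3).symm

lemma gaussCurvature_param {φ ψ : ℝ} (hg : gap a b c φ ψ ≠ 0) :
    gaussCurvature (inwardNormal a b c) (param a b c φ ψ) =
      ‖halfGradient a b c (param a b c φ ψ)‖⁻¹ ^ 2 /
        (quad (b ^ 2) (c ^ 2) φ * quad (b ^ 2) (a ^ 2) ψ) := by
  have hp := halfGradient_ne_zero (H.param_mem φ ψ)
  have hU := H.inner_paramU_self φ ψ
  have hV := H.inner_paramV_self φ ψ
  have hUV := H.inner_paramU_paramV φ ψ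
  have hμ := (H.nondegU.pos φ).ne'
  have hν := (H.nondegV.pos ψ).ne'
  have hR := (H.radU_pos φ).ne'
  have hS := (H.radV_pos ψ).ne'
  have hU0 : inner ℝ (paramU a b c φ ψ) (paramU a b c φ ψ) ≠ 0 := by
    rw [hU]; exact div_ne_zero (mul_ne_zero hμ hg) (pow_ne_zero 2 hR)
  have hV0 : inner ℝ (paramV a b c φ ψ) (paramV a b c φ ψ) ≠ 0 := by
    rw [hV]; exact div_ne_zero (mul_ne_zero hν hg) (pow_ne_zero 2 hS)
  let W := tangentPlane (inwardNormal a b c) (param a b c φ ψ)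
  let e₁ : W := ⟨paramU a b c φ ψ, (mem_tangentPlane_iff hp _).2 (H.inner_normal_paramU φ ψ)⟩
  let e₂ : W := ⟨paramV a b c φ ψ, (mem_tangentPlane_iff hp _).2 (H.inner_normal_paramV φ ψ)⟩
  rw [gaussCurvature, det_of_diagonal (finrank_tangentPlane hp) (e₁ := e₁) (e₂ := e₂)
    (k₁ := ‖halfGradient a b c (param a b c φ ψ)‖⁻¹ / quad (b ^ 2) (c ^ 2) φ)
    (k₂ := ‖halfGradient a b c (param a b c φ ψ)‖⁻¹ / quad (b ^ 2) (a ^ 2) ψ)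
    (fun h => hU0 (by simp [show paramU a b c φ ψ = 0 from congrArg Subtype.val h]))
    (fun h => hV0 (by simp [show paramV a b c φ ψ = 0 from congrArg Subtype.val h])) hUV]
  · ring
  · rw [inner_shapeOperator hp, Submodule.coe_inner, H.conjugate_paramU_self, hU]
    field_simp
  · rw [inner_shapeOperator hp, H.conjugate_paramU_paramV, mul_zero]
  · rw [inner_shapeOperator hp, inner_halfGradient_comm, H.conjugate_paramU_paramV, mul_zero]
  · rw [inner_shapeOperator hp, Submodule.coe_inner, H.conjugate_paramV_self, hV]
    field_simp

lemma gaussCurvature_param_pos {φ ψ : ℝ} (hg : gap a b c φ ψ ≠ 0) :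
    0 < gaussCurvature (inwardNormal a b c) (param a b c φ ψ) := by
  have := norm_pos_iff.2 (halfGradient_ne_zero (H.param_mem φ ψ))
  have := H.nondegU.pos φ
  have := H.nondegV.pos ψ
  rw [H.gaussCurvature_param hg]; positivity

lemma inner_normal_comb (φ ψ α β : ℝ) : inner ℝ (halfGradient a b c (param a b c φ ψ))
    (α • paramU a b c φ ψ + β • paramV a b c φ ψ) = 0 := by
  simp [inner_add_right, inner_smul_right, H.inner_normal_paramU, H.inner_normal_paramV]

lemma inner_comb_self (φ ψ α β : ℝ) :
    inner ℝ (α • paramU a b c φ ψ + β • paramV a b c φ ψ)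
      (α • paramU a b c φ ψ + β • paramV a b c φ ψ) =
    gap a b c φ ψ * (α ^ 2 * quad (b ^ 2) (c ^ 2) φ / radU a b c φ ^ 2 +
      β ^ 2 * quad (b ^ 2) (a ^ 2) ψ / radV a b c ψ ^ 2) := by
  have h1 := H.inner_paramU_paramV φ ψ
  have h2 : inner ℝ (paramV a b c φ ψ) (paramU a b c φ ψ) = 0 := by rw [real_inner_comm, h1]
  simp only [inner_add_left, inner_add_right, real_inner_smul_left, real_inner_smul_right, h1, h2,
    H.inner_paramU_self, H.inner_paramV_self]
  ring

lemma conjugate_comb_self (φ ψ α β : ℝ) :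
    inner ℝ (halfGradient a b c (α • paramU a b c φ ψ + β • paramV a b c φ ψ))
      (α • paramU a b c φ ψ + β • paramV a b c φ ψ) =
    gap a b c φ ψ * (α ^ 2 / radU a b c φ ^ 2 + β ^ 2 / radV a b c ψ ^ 2) := by
  have h1 := H.conjugate_paramU_paramV φ ψ
  have h2 : inner ℝ (halfGradient a b c (paramV a b c φ ψ)) (paramU a b c φ ψ) = 0 := by
    rw [inner_halfGradient_comm, h1]
  have h3 := H.conjugate_paramU_self φ ψ
  have h4 := H.conjugate_paramV_self φ ψ
  simp only [← halfGradientL_apply] at h1 h2 h3 h4 ⊢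
  simp only [map_add, map_smul, inner_add_left, inner_add_right, real_inner_smul_left,
    real_inner_smul_right, h1, h2, h3, h4]
  ring

/-- Equal principal curvatures would force the two ellipsoidal coordinates to agree. -/
lemma not_isUmbilic_param {φ ψ : ℝ} (hg : gap a b c φ ψ ≠ 0) :
    ¬ IsUmbilic (ellipsoid a b c) (inwardNormal a b c) (param a b c φ ψ) := by
  rintro ⟨_, k, hk⟩
  have hp := halfGradient_ne_zero (H.param_mem φ ψ)
  have hn := (norm_pos_iff.2 hp).ne'
  have hR := (H.radU_pos φ).ne'
  have hS := (H.radV_pos ψ).ne'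
  have h1 := hk _ ((mem_tangentPlane_iff hp _).2 (H.inner_normal_paramU φ ψ))
  have h2 := hk _ ((mem_tangentPlane_iff hp _).2 (H.inner_normal_paramV φ ψ))
  rw [secondFF_eq hp _ (H.inner_normal_paramU φ ψ), H.conjugate_paramU_self,
    H.inner_paramU_self] at h1
  rw [secondFF_eq hp _ (H.inner_normal_paramV φ ψ), H.conjugate_paramV_self,
    H.inner_paramV_self] at h2
  field_simp at h1 h2
  have hk0 : k ≠ 0 := by rintro rfl; simp at h1
  have h3 : quad (b ^ 2) (c ^ 2) φ = quad (b ^ 2) (a ^ 2) ψ := by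
    have : ‖halfGradient a b c (param a b c φ ψ)‖ * k ≠ 0 := mul_ne_zero hn hk0
    apply mul_left_cancel₀ this
    linear_combination h2 - h1
  exact hg (by rw [gap, h3, sub_self])

/-- At a branch point both partial derivatives of `param` vanish and do not span the tangent plane,
so the forms are compared directly in space. Both `quad` values are `b²` there, whence the
curvature. -/
lemma isUmbilic_param {φ ψ : ℝ} (hg : gap a b c φ ψ = 0) :
    IsUmbilic (ellipsoid a b c) (inwardNormal a b c) (param a b c φ ψ) := by
  have hmem := H.param_mem φ ψ
  have hp := halfGradient_ne_zero hmem
  refine ⟨hmem, ‖halfGradient a b c (param a b c φ ψ)‖⁻¹ / b ^ 2, fun v hv => ?_⟩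
  rw [mem_tangentPlane_iff hp] at hv
  rw [secondFF_eq hp _ hv, div_mul_eq_mul_div, mul_div_assoc]
  congr 1
  obtain ⟨hφ, hψ⟩ := (H.gap_eq_zero_iff φ ψ).1 hg
  have hcφ : Real.cos φ ^ 2 = 1 := by have := Real.sin_sq_add_cos_sq φ; simpa [hφ] using this
  have hcψ : Real.cos ψ ^ 2 = 1 := by have := Real.sin_sq_add_cos_sq ψ; simpa [hψ] using this
  have hR : radU a b c φ ^ 2 = a ^ 2 - b ^ 2 := by rw [H.radU_sq]; simp [quad, hφ, hcφ]
  have hS : radV a b c ψ ^ 2 = b ^ 2 - c ^ 2 := by rw [H.radV_sq]; simp [quad, hψ, hcψ]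
  have ha := H.ha.ne'; have hb := H.hb.ne'; have hc := H.hc.ne'
  have hK := H.sqrt_pos.ne'
  simp only [inner_halfGradient, param, Matrix.cons_val, hφ] at hv
  rw [inner_halfGradient, inner_eq]
  -- Tangency: the second coordinate of the point is zero, which leaves a relation between `v 0` and
  -- `v 2`. Its square is exactly what makes the two forms proportional.
  have h1 : c * (Real.cos ψ * radU a b c φ) * v 0 + a * (Real.cos φ * radV a b c ψ) * v 2 = 0 := by
    field_simp at hv
    apply mul_left_cancel₀ hb
    linear_combination hv
  have h2 : c ^ 2 * (a ^ 2 - b ^ 2) * v 0 ^ 2 = a ^ 2 * (b ^ 2 - c ^ 2) * v 2 ^ 2 := by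
    have h3 : (c * (Real.cos ψ * radU a b c φ) * v 0) ^ 2 =
        (a * (Real.cos φ * radV a b c ψ) * v 2) ^ 2 := by
      rw [eq_neg_of_add_eq_zero_left h1]; ring
    simp only [mul_pow, hR, hS, hcφ, hcψ] at h3
    linear_combination h3
  field_simp
  linear_combination -h2

/-- In terms of `σ`, the directions of geometric mean curvature are the diagonals. -/
lemma normalCurvature_eq_iff {φ ψ α β : ℝ} (hg : gap a b c φ ψ ≠ 0)
    (hv : α • paramU a b c φ ψ + β • paramV a b c φ ψ ≠ 0) :
    normalCurvature (inwardNormal a b c) (param a b c φ ψ)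
        (α • paramU a b c φ ψ + β • paramV a b c φ ψ) =
      Real.sqrt (gaussCurvature (inwardNormal a b c) (param a b c φ ψ)) ↔
    (arcDensity (b ^ 2) (c ^ 2) (a ^ 2) φ * α) ^ 2 =
      (arcDensity (b ^ 2) (a ^ 2) (c ^ 2) ψ * β) ^ 2 := by
  have hp := halfGradient_ne_zero (H.param_mem φ ψ)
  have hn := norm_pos_iff.2 hp
  have hμ := H.nondegU.pos φ
  have hν := H.nondegV.pos ψ
  have hR := H.radU_pos φ
  have hS := H.radV_pos ψ
  have hI := real_inner_self_nonneg.lt_of_ne' (inner_self_ne_zero (𝕜 := ℝ).2 hv)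
  have hgpos : 0 < gap a b c φ ψ := (H.gap_nonneg φ ψ).lt_of_ne' hg
  have habsU : |quad (b ^ 2) (c ^ 2) φ - a ^ 2| = radU a b c φ ^ 2 := by
    rw [H.radU_sq, abs_sub_comm, abs_of_pos]
    rw [← H.radU_sq]; positivity
  have habsV : |quad (b ^ 2) (a ^ 2) ψ - c ^ 2| = radV a b c ψ ^ 2 := by
    rw [H.radV_sq, abs_of_pos]
    rw [← H.radV_sq]; positivity
  rw [normalCurvature, secondFF_eq hp _ (H.inner_normal_comb _ _ _ _), H.gaussCurvature_param hg,
    Real.sqrt_div (by positivity), Real.sqrt_sq (by positivity), Real.sqrt_mul hμ.le,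
    mul_pow, mul_pow, H.nondegU.arcDensity_sq, H.nondegV.arcDensity_sq, habsU, habsV,
    mul_div_assoc, div_eq_mul_inv _ (Real.sqrt _ * _),
    mul_right_inj' (inv_ne_zero hn.ne'), H.conjugate_comb_self]
  rw [H.inner_comb_self] at hI ⊢
  have hI' := pos_of_mul_pos_right hI hgpos.le
  rw [mul_div_mul_left _ _ hgpos.ne', div_eq_iff hI'.ne']
  -- With `p = √μ` and `q = √ν`, for `μ` and `ν` the two `quad` values, the equation factors as `(q
  -- - p) (p α² / R² - q β² / S²) = 0`. The first factor vanishes only at umbilic points; the second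
  -- is the difference of the squared `σ`-components, up to the factor `4`.
  set p := Real.sqrt (quad (b ^ 2) (c ^ 2) φ) with hpdef
  set q := Real.sqrt (quad (b ^ 2) (a ^ 2) ψ) with hqdef
  have hp2 : quad (b ^ 2) (c ^ 2) φ = p ^ 2 := (Real.sq_sqrt hμ.le).symm
  have hq2 : quad (b ^ 2) (a ^ 2) ψ = q ^ 2 := (Real.sq_sqrt hν.le).symm
  have hp0 : 0 < p := Real.sqrt_pos.2 hμ
  have hq0 : 0 < q := Real.sqrt_pos.2 hν
  have hpq : q - p ≠ 0 := by
    refine sub_ne_zero.2 fun h => hg ?_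
    rw [gap, hp2, hq2, h, sub_self]
  rw [hp2, hq2]
  set R := radU a b c φ
  set S := radV a b c ψ
  constructor
  · intro h
    have h' : (q - p) * (α ^ 2 * p * S ^ 2) = (q - p) * (β ^ 2 * q * R ^ 2) := by
      field_simp at h
      linear_combination h
    have h'' := mul_left_cancel₀ hpq h'
    field_simp
    linear_combination h''
  · intro h
    field_simp at h ⊢
    linear_combination (q - p) * h

lemma hasDerivAt_radU (φ : ℝ) : HasDerivAt (radU a b c)
    ((b ^ 2 - c ^ 2) * Real.sin φ * Real.cos φ / radU a b c φ) φ := by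
  have h0 : a ^ 2 - quad (b ^ 2) (c ^ 2) φ ≠ 0 := by
    rw [← H.radU_sq]; exact (pow_pos (H.radU_pos φ) 2).ne'
  have h1 := ((hasDerivAt_quad (b ^ 2) (c ^ 2) φ).const_sub (a ^ 2)).sqrt h0
  refine h1.congr_deriv ?_
  change _ / (2 * radU a b c φ) = _
  have := (H.radU_pos φ).ne'
  field_simp

lemma hasDerivAt_radV (ψ : ℝ) : HasDerivAt (radV a b c)
    ((a ^ 2 - b ^ 2) * Real.sin ψ * Real.cos ψ / radV a b c ψ) ψ := by
  have h0 : quad (b ^ 2) (a ^ 2) ψ - c ^ 2 ≠ 0 := by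
    rw [← H.radV_sq]; exact (pow_pos (H.radV_pos ψ) 2).ne'
  have h1 := ((hasDerivAt_quad (b ^ 2) (a ^ 2) ψ).sub_const (c ^ 2)).sqrt h0
  refine h1.congr_deriv ?_
  change _ / (2 * radV a b c ψ) = _
  have := (H.radV_pos ψ).ne'
  field_simp
  ring

lemma hasDerivAt_param {f g : ℝ → ℝ} {f' g' t : ℝ} (hf : HasDerivAt f f' t)
    (hg : HasDerivAt g g' t) : HasDerivAt (fun s => param a b c (f s) (g s))
      (f' • paramU a b c (f t) (g t) + g' • paramV a b c (f t) (g t)) t := by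
  have hR := (H.hasDerivAt_radU (f t)).comp t hf
  have hS := (H.hasDerivAt_radV (g t)).comp t hg
  apply hasDerivAt_E3
  · have h1 := ((hg.cos.const_mul a).mul hR).div_const (Real.sqrt (a ^ 2 - c ^ 2))
    refine h1.congr_deriv ?_
    simp [paramU, paramV]; ring
  · have h1 := (hf.sin.const_mul b).mul hg.sin
    refine h1.congr_deriv ?_
    simp [paramU, paramV]; ring
  · have h1 := ((hf.cos.const_mul c).mul hS).div_const (Real.sqrt (a ^ 2 - c ^ 2))
    refine h1.congr_deriv ?_
    simp [paramU, paramV]; ring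

lemma contDiff_param : ContDiff ℝ 1 (fun q : ℝ × ℝ => param a b c q.1 q.2) := by
  have hR : ContDiff ℝ 1 (fun q : ℝ × ℝ => radU a b c q.1) := by
    refine ContDiff.sqrt (by unfold quad; fun_prop) fun q => ?_
    rw [← H.radU_sq]; exact (pow_pos (H.radU_pos _) 2).ne'
  have hS : ContDiff ℝ 1 (fun q : ℝ × ℝ => radV a b c q.2) := by
    refine ContDiff.sqrt (by unfold quad; fun_prop) fun q => ?_
    rw [← H.radV_sq]; exact (pow_pos (H.radV_pos _) 2).ne'
  rw [contDiff_euclidean]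
  intro i
  fin_cases i <;> simp only [param, PiLp.toLp_apply] <;> simp <;> fun_prop

lemma continuous_param {X : Type*} [TopologicalSpace X] {f g : X → ℝ} (hf : Continuous f)
    (hg : Continuous g) : Continuous (fun x => param a b c (f x) (g x)) :=
  Continuous.comp (g := fun q : ℝ × ℝ => param a b c q.1 q.2) (f := fun x => (f x, g x))
    H.contDiff_param.continuous (hf.prodMk hg)

lemma continuous_paramU {X : Type*} [TopologicalSpace X] {f g : X → ℝ} (hf : Continuous f)
    (hg : Continuous g) : Continuous (fun x => paramU a b c (f x) (g x)) := by
  have hR : Continuous (fun x => radU a b c (f x)) := by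
    unfold radU quad; fun_prop
  have hR0 : ∀ x, radU a b c (f x) ≠ 0 := fun x => (H.radU_pos (f x)).ne'
  have hS : Continuous (fun x => radV a b c (g x)) := by
    unfold radV quad; fun_prop
  refine (PiLp.continuous_toLp 2 _).comp (continuous_pi fun i => ?_)
  fin_cases i <;> simp <;> fun_prop (disch := exact hR0)

lemma continuous_paramV {X : Type*} [TopologicalSpace X] {f g : X → ℝ} (hf : Continuous f)
    (hg : Continuous g) : Continuous (fun x => paramV a b c (f x) (g x)) := by
  have hR : Continuous (fun x => radU a b c (f x)) := by
    unfold radU quad; fun_prop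
  have hS0 : ∀ x, radV a b c (g x) ≠ 0 := fun x => (H.radV_pos (g x)).ne'
  have hS : Continuous (fun x => radV a b c (g x)) := by
    unfold radV quad; fun_prop
  refine (PiLp.continuous_toLp 2 _).comp (continuous_pi fun i => ?_)
  fin_cases i <;> simp <;> fun_prop (disch := exact hS0)

end Triaxial

/-! ### Surjectivity of the parametrization -/

lemma exists_cos_sin {ξ η : ℝ} (h : ξ ^ 2 + η ^ 2 = 1) : ∃ θ, Real.cos θ = ξ ∧ Real.sin θ = η := by
  have h1 : -1 ≤ ξ := by nlinarith [sq_nonneg η]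
  have h2 : ξ ≤ 1 := by nlinarith [sq_nonneg η]
  have h3 : Real.sqrt (1 - ξ ^ 2) = |η| := by
    rw [show 1 - ξ ^ 2 = η ^ 2 by linarith, Real.sqrt_sq_eq_abs]
  rcases le_total 0 η with hη | hη
  · exact ⟨Real.arccos ξ, Real.cos_arccos h1 h2, by rw [Real.sin_arccos, h3, abs_of_nonneg hη]⟩
  · refine ⟨-Real.arccos ξ, by rw [Real.cos_neg, Real.cos_arccos h1 h2], ?_⟩
    rw [Real.sin_neg, Real.sin_arccos, h3, abs_of_nonpos hη, neg_neg]

/-- The squared cosines of the angles with given squared coordinates. -/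
lemma exists_sq_cos {m n x y z : ℝ} (hm : 0 < m) (hn : 0 < n) (hx : 0 ≤ x) (hy : 0 ≤ y)
    (hz : 0 ≤ z) (h : x + y + z = 1) :
    ∃ C D : ℝ, C ∈ Icc 0 1 ∧ D ∈ Icc 0 1 ∧ D * (m + n - m * C) = (m + n) * x ∧
      C * (m + n - n * D) = (m + n) * z ∧ (1 - C) * (1 - D) = y := by
  -- Eliminating `D` from the first two equations leaves a quadratic in `C`, with value `-(m + n) z
  -- ≤ 0` at `0` and `n y ≥ 0` at `1`.
  obtain ⟨C, hC, hC0⟩ : (0 : ℝ) ∈ (fun C : ℝ => C * (m + n - m * C - n * x) -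
      z * (m + n - m * C)) '' Icc 0 1 := by
    refine intermediate_value_Icc zero_le_one (by fun_prop) ⟨?_, ?_⟩
    · nlinarith
    · nlinarith
  simp only at hC0
  have hpos : 0 < m + n - m * C := by nlinarith [hC.1, hC.2]
  have key : ∀ D, D * (m + n - m * C) = (m + n) * x → C * (m + n - n * D) = (m + n) * z →
      (1 - C) * (1 - D) = y := by
    intro D h1 h2
    have : (m + n) * ((1 - C) * (1 - D)) = (m + n) * y := by
      linear_combination -h1 - h2 - (m + n) * h
    exact mul_left_cancel₀ (by positivity) this
  have hD : (m + n) * x / (m + n - m * C) * (m + n - m * C) = (m + n) * x :=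
    div_mul_cancel₀ _ hpos.ne'
  have hD0 : 0 ≤ (m + n) * x / (m + n - m * C) := by positivity
  have hCD : C * (m + n - n * ((m + n) * x / (m + n - m * C))) = (m + n) * z := by
    apply mul_right_cancel₀ hpos.ne'
    linear_combination (m + n) * hC0 - C * n * hD
  -- For `C < 1` the product equation and `0 ≤ y` give `D ≤ 1`. For `C = 1` that equation says
  -- nothing about `D`, and the value found may exceed `1`; then `y = 0`, and `D = 1` with another
  -- `C` is a solution.
  rcases hC.2.lt_or_eq with hlt | rfl
  · have h5 := key _ hD hCD
    refine ⟨C, _, hC, ⟨hD0, ?_⟩, hD, hCD, h5⟩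
    by_contra! hc
    nlinarith
  · rcases le_or_gt ((m + n) * x) n with hle | hgt
    · refine ⟨1, _, hC, ⟨hD0, ?_⟩, hD, hCD, key _ hD hCD⟩
      rw [div_le_one hpos]; linarith
    · have hy0 : y = 0 := by
        have : n * y = 0 := by linear_combination hC0 + n * h
        simpa [hn.ne'] using this
      refine ⟨(m + n) * z / m, 1, ⟨by positivity, ?_⟩, ⟨zero_le_one, le_rfl⟩, ?_, ?_, by simp [hy0]⟩
      · rw [div_le_one hm]
        have : (m + n) * z = (m + n) - (m + n) * x := by linear_combination (m + n) * (h - hy0)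
        linarith
      · field_simp
        linear_combination hy0 - h
      · field_simp
        ring

namespace Triaxial

variable {a b c : ℝ} (H : Triaxial a b c)

include H

lemma exists_param_eq {p : E3} (hp : p ∈ ellipsoid a b c) : ∃ φ ψ, param a b c φ ψ = p := by
  have ha := H.ha.ne'; have hb := H.hb.ne'; have hc := H.hc.ne'
  have hm := sub_pos.2 H.sq_lt_right
  have hn := sub_pos.2 H.sq_lt_left
  have hK := H.sqrt_pos
  have hK2 := H.sqrt_sq
  obtain ⟨C, D, hC, hD, h1, h2, h3⟩ := exists_sq_cos hm hn (x := (p 0 / a) ^ 2)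
    (y := (p 1 / b) ^ 2) (z := (p 2 / c) ^ 2) (by positivity) (by positivity) (by positivity)
    (by rw [← hp]; ring)
  have hR : 0 < b ^ 2 - c ^ 2 + (a ^ 2 - b ^ 2) - (b ^ 2 - c ^ 2) * C := by
    nlinarith [hC.1, hC.2]
  have hS : 0 < b ^ 2 - c ^ 2 + (a ^ 2 - b ^ 2) - (a ^ 2 - b ^ 2) * D := by
    nlinarith [hD.1, hD.2]
  set R := Real.sqrt (b ^ 2 - c ^ 2 + (a ^ 2 - b ^ 2) - (b ^ 2 - c ^ 2) * C) with hRdef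
  set S := Real.sqrt (b ^ 2 - c ^ 2 + (a ^ 2 - b ^ 2) - (a ^ 2 - b ^ 2) * D) with hSdef
  have hR2 := Real.sq_sqrt hR.le
  have hS2 := Real.sq_sqrt hS.le
  rw [← hRdef] at hR2
  rw [← hSdef] at hS2
  have hR0 : 0 < R := Real.sqrt_pos.2 hR
  have hS0 : 0 < S := Real.sqrt_pos.2 hS
  have hcφ : (p 2 / c * Real.sqrt (a ^ 2 - c ^ 2) / S) ^ 2 = C := by
    rw [div_pow, mul_pow, hK2, div_eq_iff (by positivity), hS2]
    linear_combination -h2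
  have hcψ : (p 0 / a * Real.sqrt (a ^ 2 - c ^ 2) / R) ^ 2 = D := by
    rw [div_pow, mul_pow, hK2, div_eq_iff (by positivity), hR2]
    linear_combination -h1
  have hC1 : 0 ≤ 1 - C := by linarith [hC.2]
  have hD1 : 0 ≤ 1 - D := by linarith [hD.2]
  -- The sine of `φ` is taken nonnegative, so the sine of `ψ` has to carry the sign of the middle
  -- coordinate.
  obtain ⟨σ, hσ, hσy⟩ : ∃ σ : ℝ, σ ^ 2 = 1 ∧ σ * |p 1 / b| = p 1 / b := by
    rcases le_total 0 (p 1 / b) with h | h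
    · exact ⟨1, by norm_num, by rw [abs_of_nonneg h, one_mul]⟩
    · exact ⟨-1, by norm_num, by rw [abs_of_nonpos h]; ring⟩
  obtain ⟨φ, hφc, hφs⟩ := exists_cos_sin (ξ := p 2 / c * Real.sqrt (a ^ 2 - c ^ 2) / S)
    (η := Real.sqrt (1 - C)) (by rw [hcφ, Real.sq_sqrt hC1]; ring)
  obtain ⟨ψ, hψc, hψs⟩ := exists_cos_sin (ξ := p 0 / a * Real.sqrt (a ^ 2 - c ^ 2) / R)
    (η := σ * Real.sqrt (1 - D)) (by rw [hcψ, mul_pow, Real.sq_sqrt hD1, hσ]; ring)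
  have hradU : radU a b c φ = R := by
    rw [radU, hRdef, quad, hφc, hφs, hcφ, Real.sq_sqrt hC1]; congr 1; ring
  have hradV : radV a b c ψ = S := by
    rw [radV, hSdef, quad, hψc, hψs, hcψ, mul_pow, Real.sq_sqrt hD1, hσ]; congr 1; ring
  refine ⟨φ, ψ, E3.ext ?_ ?_ ?_⟩
  · simp only [param, Matrix.cons_val, hψc, hradU]; field_simp
  · simp only [param, Matrix.cons_val, hφs, hψs]
    have : Real.sqrt (1 - C) * Real.sqrt (1 - D) = |p 1 / b| := by
      rw [← Real.sqrt_mul hC1, h3, Real.sqrt_sq_eq_abs]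
    calc b * Real.sqrt (1 - C) * (σ * Real.sqrt (1 - D))
        = b * (σ * (Real.sqrt (1 - C) * Real.sqrt (1 - D))) := by ring
      _ = p 1 := by rw [this, hσy]; field_simp
  · simp only [param, Matrix.cons_val, hφc, hradV]; field_simp

lemma paramU_paramV_independent {φ ψ α β : ℝ} (hg : gap a b c φ ψ ≠ 0)
    (h : α • paramU a b c φ ψ + β • paramV a b c φ ψ = 0) : α = 0 ∧ β = 0 := by
  have hU := H.inner_paramU_self φ ψ
  have hV := H.inner_paramV_self φ ψ
  have hUV := H.inner_paramU_paramV φ ψ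
  have hU0 : inner ℝ (paramU a b c φ ψ) (paramU a b c φ ψ) ≠ 0 := by
    rw [hU]; exact div_ne_zero (mul_ne_zero (H.nondegU.pos φ).ne' hg) (pow_pos (H.radU_pos φ) 2).ne'
  have hV0 : inner ℝ (paramV a b c φ ψ) (paramV a b c φ ψ) ≠ 0 := by
    rw [hV]; exact div_ne_zero (mul_ne_zero (H.nondegV.pos ψ).ne' hg) (pow_pos (H.radV_pos ψ) 2).ne'
  constructor
  · have := congrArg (fun v => inner ℝ (paramU a b c φ ψ) v) h
    simp only [inner_add_right, real_inner_smul_right, hUV, inner_zero_right, mul_zero, add_zero] at this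
    exact (mul_eq_zero.1 this).resolve_right hU0
  · have := congrArg (fun v => inner ℝ v (paramV a b c φ ψ)) h
    simp only [inner_add_left, real_inner_smul_left, hUV, inner_zero_left, mul_zero, zero_add] at this
    exact (mul_eq_zero.1 this).resolve_right hV0

lemma comb_injective {φ ψ α β α' β' : ℝ} (hg : gap a b c φ ψ ≠ 0)
    (h : α • paramU a b c φ ψ + β • paramV a b c φ ψ =
      α' • paramU a b c φ ψ + β' • paramV a b c φ ψ) : α = α' ∧ β = β' := by
  have h1 : (α - α') • paramU a b c φ ψ + (β - β') • paramV a b c φ ψ = 0 := by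
    rw [sub_smul, sub_smul, sub_add_sub_comm, h, sub_self]
  obtain ⟨h2, h3⟩ := H.paramU_paramV_independent hg h1
  exact ⟨sub_eq_zero.1 h2, sub_eq_zero.1 h3⟩

/-- The parametrization and the homotheties give local coordinates of the space. -/
lemma exists_cone_equiv {φ ψ : ℝ} (hg : gap a b c φ ψ ≠ 0) :
    ∃ L : ((ℝ × ℝ) × ℝ) ≃L[ℝ] E3,
      HasFDerivAt (fun q : (ℝ × ℝ) × ℝ => q.2 • param a b c q.1.1 q.1.2)
        (L : ((ℝ × ℝ) × ℝ) →L[ℝ] E3) ((φ, ψ), 1) := by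
  have hd : ContDiff ℝ 1 (fun q : (ℝ × ℝ) × ℝ => q.2 • param a b c q.1.1 q.1.2) :=
    contDiff_snd.smul (H.contDiff_param.comp contDiff_fst)
  have hF := (hd.differentiable one_ne_zero ((φ, ψ), 1)).hasFDerivAt
  set L₀ := fderiv ℝ (fun q : (ℝ × ℝ) × ℝ => q.2 • param a b c q.1.1 q.1.2) ((φ, ψ), 1)
  have hL : ∀ x : (ℝ × ℝ) × ℝ, L₀ x =
      x.1.1 • paramU a b c φ ψ + x.1.2 • paramV a b c φ ψ + x.2 • param a b c φ ψ := by
    intro x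
    have hlin : ∀ r y : ℝ, HasDerivAt (fun s : ℝ => y + s * r) r 0 := fun r y => by
      simpa using ((hasDerivAt_id (0 : ℝ)).mul_const r).const_add y
    have h1 : HasDerivAt (fun s : ℝ => (((φ + s * x.1.1, ψ + s * x.1.2), 1 + s * x.2) : (ℝ × ℝ) × ℝ))
        ((x.1.1, x.1.2), x.2) 0 :=
      ((hlin _ _).prodMk (hlin _ _)).prodMk (hlin _ _)
    have h2 := HasFDerivAt.comp_hasDerivAt_of_eq (0 : ℝ) hF h1 (by simp)
    have h3 := (hlin x.2 1).smul (H.hasDerivAt_param (hlin x.1.1 φ) (hlin x.1.2 ψ))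
    have h4 := h2.unique h3
    simpa using h4
  have hinj : Function.Injective (L₀ : ((ℝ × ℝ) × ℝ) →ₗ[ℝ] E3) := by
    rw [← LinearMap.ker_eq_bot, LinearMap.ker_eq_bot']
    intro x hx
    have hx' : x.1.1 • paramU a b c φ ψ + x.1.2 • paramV a b c φ ψ + x.2 • param a b c φ ψ = 0 := by
      rw [← hL]; exact hx
    -- The gradient is orthogonal to both partial derivatives and pairs to `1` with the point, so it
    -- isolates the radial component.
    have h1 := congrArg (fun v => inner ℝ (halfGradient a b c (param a b c φ ψ)) v) hx'
    simp only [inner_add_right, real_inner_smul_right, H.inner_normal_paramU,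
      H.inner_normal_paramV, inner_halfGradient_self_of_mem (H.param_mem φ ψ), inner_zero_right] at h1
    have h2 : x.2 = 0 := by simpa using h1
    rw [h2, zero_smul, add_zero] at hx'
    obtain ⟨h3, h4⟩ := H.paramU_paramV_independent hg hx'
    exact Prod.ext (Prod.ext h3 h4) h2
  refine ⟨(LinearMap.linearEquivOfInjective _ hinj (by simp)).toContinuousLinearEquiv, ?_⟩
  exact hF.congr_fderiv (ContinuousLinearMap.ext fun x => rfl)

/-- A curve on the ellipsoid lifts locally away from the umbilic points. -/
lemma exists_local_lift {γ : ℝ → E3} {t φ ψ : ℝ} (hγ : ContDiffAt ℝ 1 γ t)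
    (hmem : ∀ᶠ s in 𝓝 t, γ s ∈ ellipsoid a b c) (h0 : γ t = param a b c φ ψ)
    (hg : gap a b c φ ψ ≠ 0) :
    ∃ f g : ℝ → ℝ, ContDiffAt ℝ 1 f t ∧ ContDiffAt ℝ 1 g t ∧ f t = φ ∧ g t = ψ ∧
      ∀ᶠ s in 𝓝 t, γ s = param a b c (f s) (g s) := by
  obtain ⟨L, hL⟩ := H.exists_cone_equiv hg
  have hd : ContDiffAt ℝ 1 (fun q : (ℝ × ℝ) × ℝ => q.2 • param a b c q.1.1 q.1.2) ((φ, ψ), 1) :=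
    (contDiff_snd.smul (H.contDiff_param.comp contDiff_fst)).contDiffAt
  have h0' : γ t = (fun q : (ℝ × ℝ) × ℝ => q.2 • param a b c q.1.1 q.1.2) ((φ, ψ), 1) := by
    simp [h0]
  have hi : ContDiffAt ℝ 1 (hd.localInverse hL one_ne_zero) (γ t) := by
    rw [h0']; exact hd.to_localInverse hL one_ne_zero
  have hr : ∀ᶠ y in 𝓝 (γ t), (fun q : (ℝ × ℝ) × ℝ => q.2 • param a b c q.1.1 q.1.2)
      (hd.localInverse hL one_ne_zero y) = y := by
    rw [h0']; exact (hd.hasStrictFDerivAt' hL one_ne_zero).eventually_right_inverse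
  have hv : hd.localInverse hL one_ne_zero (γ t) = ((φ, ψ), 1) := by
    rw [h0']; exact hd.localInverse_apply_image hL one_ne_zero
  set l := hd.localInverse hL one_ne_zero
  have hl : ContDiffAt ℝ 1 (fun s => l (γ s)) t := hi.comp t hγ
  refine ⟨fun s => (l (γ s)).1.1, fun s => (l (γ s)).1.2, hl.fst.fst, hl.fst.snd, by simp [hv],
    by simp [hv], ?_⟩
  -- The local inverse yields a point of the ellipsoid times a radial factor `r`. As `γ s` is on the
  -- ellipsoid too, `r² = 1`, and continuity from `r = 1` at `t` excludes `-1`.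
  have h2 : ∀ᶠ s in 𝓝 t, 0 < (l (γ s)).2 := by
    have hc : ContinuousAt (fun s => (l (γ s)).2) t := hl.snd.continuousAt
    exact hc.eventually_const_lt (by simp [hv])
  filter_upwards [hmem, h2, hγ.continuousAt.eventually hr] with s hs1 hs2 hs3
  have hP := inner_halfGradient_self_of_mem (H.param_mem (l (γ s)).1.1 (l (γ s)).1.2)
  have hQ := inner_halfGradient_self_of_mem hs1
  rw [← hs3, ← halfGradientL_apply, map_smul, real_inner_smul_left, real_inner_smul_right,
    halfGradientL_apply, hP, mul_one] at hQ
  have h1 : (l (γ s)).2 = 1 := by nlinarith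
  rw [h1, one_smul] at hs3
  exact hs3.symm

end Triaxial

lemma eventually_eq_of_hasDerivAt_zero {k : ℝ → ℝ} {t : ℝ} (h : ∀ᶠ s in 𝓝 t, HasDerivAt k 0 s) :
    ∀ᶠ s in 𝓝 t, k s = k t := by
  obtain ⟨r, hr, hB⟩ := Metric.eventually_nhds_iff_ball.1 h
  filter_upwards [Metric.ball_mem_nhds t hr] with s hs
  exact Metric.isOpen_ball.is_const_of_deriv_eq_zero (convex_ball t r).isPreconnected
    (fun x hx => (hB x hx).differentiableAt.differentiableWithinAt)
    (fun x hx => (hB x hx).deriv) hs (Metric.mem_ball_self hr)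

/-- This is the deck transformation of the twofold covering. It reverses the coordinate velocities,
so a lift of a line can be chosen with increasing first angle. -/
lemma param_neg (a b c φ ψ : ℝ) : param a b c (-φ) (-ψ) = param a b c φ ψ := by
  simp [param, radU, radV, quad]

lemma paramU_neg (a b c φ ψ : ℝ) : paramU a b c (-φ) (-ψ) = -paramU a b c φ ψ := by
  apply E3.ext <;> simp [paramU, radU, radV, quad] <;> ring

lemma paramV_neg (a b c φ ψ : ℝ) : paramV a b c (-φ) (-ψ) = -paramV a b c φ ψ := by
  apply E3.ext <;> simp [paramV, radU, radV, quad] <;> ring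

namespace Triaxial

variable {a b c : ℝ} (H : Triaxial a b c) (ε d : ℝ)

/-! ### The lines `dσ(v) = ε dσ(u)` -/

/-- The second angle as a function of the first one along the line `σ(v) = ε σ(u) + d`. -/
def lineV (φ : ℝ) : ℝ := H.nondegV.arcIso.symm (ε * arcLength (b ^ 2) (c ^ 2) (a ^ 2) φ + d)

/-- The derivative of `lineV`. -/
def slope (φ : ℝ) : ℝ :=
  ε * arcDensity (b ^ 2) (c ^ 2) (a ^ 2) φ / arcDensity (b ^ 2) (a ^ 2) (c ^ 2) (H.lineV ε d φ)

/-- The derivative of the line on the ellipsoid with respect to the first angle. -/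
def lineTangent (φ : ℝ) : E3 :=
  paramU a b c φ (H.lineV ε d φ) + H.slope ε d φ • paramV a b c φ (H.lineV ε d φ)

/-- The arclength along the line. -/
def lineLength (φ : ℝ) : ℝ := ∫ x in (0 : ℝ)..φ, ‖H.lineTangent ε d x‖

lemma continuous_lineV : Continuous (H.lineV ε d) :=
  H.nondegV.continuous_arcIso_symm.comp
    ((continuous_const.mul H.nondegU.continuous_arcLength).add continuous_const)

lemma arcLength_lineV (φ : ℝ) : arcLength (b ^ 2) (a ^ 2) (c ^ 2) (H.lineV ε d φ) =
    ε * arcLength (b ^ 2) (c ^ 2) (a ^ 2) φ + d :=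
  H.nondegV.arcLength_arcIso_symm _

variable {ε d} in
lemma lineV_eq {φ ψ : ℝ} (h : arcLength (b ^ 2) (a ^ 2) (c ^ 2) ψ =
    ε * arcLength (b ^ 2) (c ^ 2) (a ^ 2) φ + d) : H.lineV ε d φ = ψ := by
  rw [lineV, ← h, Nondegenerate.arcIso_symm_arcLength]

lemma hasDerivAt_lineV (φ : ℝ) : HasDerivAt (H.lineV ε d) (H.slope ε d φ) φ := by
  have h1 := (((H.nondegU.hasDerivAt_arcLength φ).const_mul ε).add_const d)
  have h2 := (H.nondegV.hasDerivAt_arcIso_symm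
    (ε * arcLength (b ^ 2) (c ^ 2) (a ^ 2) φ + d)).comp φ h1
  refine h2.congr_deriv ?_
  rw [slope, lineV]; ring

lemma continuous_lineTangent : Continuous (H.lineTangent ε d) := by
  have h1 := H.continuous_lineV ε d
  have h2 : Continuous (H.slope ε d) := by
    refine Continuous.div (continuous_const.mul H.nondegU.continuous_arcDensity)
      (H.nondegV.continuous_arcDensity.comp h1) fun φ => (H.nondegV.arcDensity_pos _).ne'
  have hU : Continuous fun φ => paramU a b c φ (H.lineV ε d φ) :=
    H.continuous_paramU continuous_id h1
  have hV : Continuous fun φ => paramV a b c φ (H.lineV ε d φ) :=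
    H.continuous_paramV continuous_id h1
  exact hU.add (h2.smul hV)

lemma hasDerivAt_lineLength (φ : ℝ) :
    HasDerivAt (H.lineLength ε d) ‖H.lineTangent ε d φ‖ φ :=
  (H.continuous_lineTangent ε d).norm.integral_hasStrictDerivAt 0 φ |>.hasDerivAt

lemma lineTangent_ne_zero {φ : ℝ} (hg : gap a b c φ (H.lineV ε d φ) ≠ 0) :
    H.lineTangent ε d φ ≠ 0 := by
  intro h
  have := H.paramU_paramV_independent hg (α := 1) (β := H.slope ε d φ)
    (by rw [one_smul]; exact h)
  exact one_ne_zero this.1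

include H in
lemma speedBound_pos : 0 < Real.sqrt (b ^ 2 - c ^ 2) * c / a :=
  div_pos (mul_pos (Real.sqrt_pos.2 (sub_pos.2 H.sq_lt_right)) H.hc) H.ha

/-- The tangent vanishes at umbilic points, so no positive constant need bound the speed from below.
The squared speed is at least a constant times `gap`, hence times `sin² φ`; the weaker bound of the
speed by `sin²` in place of `|sin|` is used because `sin²` has an elementary primitive. -/
lemma le_norm_lineTangent (φ : ℝ) :
    Real.sqrt (b ^ 2 - c ^ 2) * c / a * Real.sin φ ^ 2 ≤ ‖H.lineTangent ε d φ‖ := by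
  have hm := sub_pos.2 H.sq_lt_right
  have hn := sub_pos.2 H.sq_lt_left
  have ha := H.ha
  have hc := H.hc
  have hk := H.speedBound_pos
  set ψ := H.lineV ε d φ
  have h1 : ‖H.lineTangent ε d φ‖ ^ 2 =
      gap a b c φ ψ * (1 ^ 2 * quad (b ^ 2) (c ^ 2) φ / radU a b c φ ^ 2 +
        H.slope ε d φ ^ 2 * quad (b ^ 2) (a ^ 2) ψ / radV a b c ψ ^ 2) := by
    rw [← real_inner_self_eq_norm_sq, lineTangent, ← one_smul ℝ (paramU a b c φ ψ)]
    exact H.inner_comb_self φ ψ 1 (H.slope ε d φ)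
  have hs1 : Real.sin φ ^ 2 ≤ 1 := Real.sin_sq_le_one φ
  have hs0 := sq_nonneg (Real.sin φ)
  have h2 : (b ^ 2 - c ^ 2) * Real.sin φ ^ 2 ≤ gap a b c φ ψ := by
    rw [gap_eq]; have := mul_nonneg hn.le (sq_nonneg (Real.sin ψ)); linarith
  have h3 : c ^ 2 / a ^ 2 ≤ 1 ^ 2 * quad (b ^ 2) (c ^ 2) φ / radU a b c φ ^ 2 +
      H.slope ε d φ ^ 2 * quad (b ^ 2) (a ^ 2) ψ / radV a b c ψ ^ 2 := by
    have h4 : c ^ 2 / a ^ 2 ≤ 1 ^ 2 * quad (b ^ 2) (c ^ 2) φ / radU a b c φ ^ 2 := by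
      rw [one_pow, one_mul]
      have hR : radU a b c φ ^ 2 ≤ a ^ 2 := by
        rw [H.radU_sq]; linarith [H.nondegU.pos φ]
      exact div_le_div₀ (H.nondegU.pos φ).le (H.mu_bounds φ).1 (pow_pos (H.radU_pos φ) 2) hR
    have h5 : 0 ≤ H.slope ε d φ ^ 2 * quad (b ^ 2) (a ^ 2) ψ / radV a b c ψ ^ 2 := by
      have := H.nondegV.pos ψ
      positivity
    linarith
  refine le_of_sq_le_sq ?_ (norm_nonneg _)
  rw [h1]
  calc (Real.sqrt (b ^ 2 - c ^ 2) * c / a * Real.sin φ ^ 2) ^ 2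
      = (b ^ 2 - c ^ 2) * Real.sin φ ^ 2 * (c ^ 2 / a ^ 2) * Real.sin φ ^ 2 := by
        rw [mul_pow, div_pow, mul_pow, Real.sq_sqrt hm.le]; ring
    _ ≤ (b ^ 2 - c ^ 2) * Real.sin φ ^ 2 * (c ^ 2 / a ^ 2) * 1 := by gcongr
    _ ≤ _ := by rw [mul_one]; gcongr; exact H.gap_nonneg φ ψ

/-- A primitive of `sin²`. -/
lemma hasDerivAt_primitive_sin_sq (φ : ℝ) :
    HasDerivAt (fun x : ℝ => (x - Real.sin x * Real.cos x) / 2) (Real.sin φ ^ 2) φ := by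
  have h := ((hasDerivAt_id φ).sub ((Real.hasDerivAt_sin φ).mul (Real.hasDerivAt_cos φ))).div_const 2
  refine h.congr_deriv ?_
  have := Real.sin_sq_add_cos_sq φ
  linear_combination (-1 / 2 : ℝ) * this

lemma lineLength_sub_ge {x y : ℝ} (hxy : x ≤ y) :
    Real.sqrt (b ^ 2 - c ^ 2) * c / a *
      ((y - Real.sin y * Real.cos y) / 2 - (x - Real.sin x * Real.cos x) / 2) ≤
    H.lineLength ε d y - H.lineLength ε d x := by
  set k := Real.sqrt (b ^ 2 - c ^ 2) * c / a
  have hd : ∀ z, HasDerivAt (fun z => H.lineLength ε d z - k * ((z - Real.sin z * Real.cos z) / 2))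
      (‖H.lineTangent ε d z‖ - k * Real.sin z ^ 2) z := fun z =>
    (H.hasDerivAt_lineLength ε d z).sub ((hasDerivAt_primitive_sin_sq z).const_mul k)
  have hm : Monotone (fun z => H.lineLength ε d z - k * ((z - Real.sin z * Real.cos z) / 2)) :=
    monotone_of_deriv_nonneg (fun z => (hd z).differentiableAt) fun z => by
      rw [(hd z).deriv]; exact sub_nonneg.2 (H.le_norm_lineTangent ε d z)
  have := hm hxy
  simp only at this
  linarith

lemma strictMono_lineLength : StrictMono (H.lineLength ε d) := by
  intro x y hxy
  have h1 := H.lineLength_sub_ge ε d hxy.le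
  -- The primitive of `sin²` is strictly increasing although `sin²` has zeros, since `sin y cos y -
  -- sin x cos x = sin (y - x) cos (y + x)`.
  have h2 : (x - Real.sin x * Real.cos x) / 2 < (y - Real.sin y * Real.cos y) / 2 := by
    have h3 : Real.sin y * Real.cos y - Real.sin x * Real.cos x =
        Real.sin (y - x) * Real.cos (y + x) := by
      rw [Real.sin_sub, Real.cos_add]
      have h4 := Real.sin_sq_add_cos_sq x
      have h5 := Real.sin_sq_add_cos_sq y
      linear_combination -(Real.sin y * Real.cos y) * h4 + Real.sin x * Real.cos x * h5
    have h6 : |Real.sin (y - x) * Real.cos (y + x)| < y - x := by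
      rw [abs_mul]
      calc _ ≤ |Real.sin (y - x)| * 1 := by gcongr; exact Real.abs_cos_le_one _
        _ < y - x := by
          rw [mul_one]
          exact (Real.abs_sin_lt_abs (sub_pos.2 hxy).ne').trans_eq (abs_of_pos (sub_pos.2 hxy))
    have := (abs_lt.1 h6).2
    linarith
  have := mul_pos H.speedBound_pos (sub_pos.2 h2)
  linarith

lemma lineLength_zero : H.lineLength ε d 0 = 0 := by simp [lineLength]

lemma continuous_lineLength : Continuous (H.lineLength ε d) :=
  continuous_iff_continuousAt.2 fun x => (H.hasDerivAt_lineLength ε d x).continuousAt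

lemma surjective_lineLength : Function.Surjective (H.lineLength ε d) := by
  have hk := H.speedBound_pos
  have hsc : ∀ x : ℝ, |Real.sin x * Real.cos x| ≤ 1 := fun x => by
    rw [abs_mul]
    exact mul_le_one₀ (Real.abs_sin_le_one x) (abs_nonneg _) (Real.abs_cos_le_one x)
  have hmono := (H.strictMono_lineLength ε d).monotone
  set k := Real.sqrt (b ^ 2 - c ^ 2) * c / a
  refine (H.continuous_lineLength ε d).surjective
    -- The primitive at `x` is at least `(x - 1) / 2`, which equals `|y| / k` for this witness.
    (tendsto_atTop_atTop_of_monotone hmono fun y => ⟨2 * |y| / k + 1, ?_⟩)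
    (tendsto_atBot_atBot_of_monotone hmono fun y => ⟨-(2 * |y| / k + 1), ?_⟩)
  · have h := H.lineLength_sub_ge ε d (x := 0) (y := 2 * |y| / k + 1) (by positivity)
    rw [lineLength_zero] at h
    have h2 := (abs_le.1 (hsc (2 * |y| / k + 1))).2
    have h3 : k * (|y| / k) ≤ k * ((2 * |y| / k + 1 - Real.sin (2 * |y| / k + 1) *
        Real.cos (2 * |y| / k + 1)) / 2 - (0 - Real.sin 0 * Real.cos 0) / 2) := by
      refine mul_le_mul_of_nonneg_left ?_ hk.le
      rw [Real.sin_zero, mul_div_assoc] at *; linarith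
    rw [mul_div_cancel₀ _ hk.ne'] at h3
    change k * _ ≤ _ at h
    linarith [le_abs_self y]
  · have h := H.lineLength_sub_ge ε d (x := -(2 * |y| / k + 1)) (y := 0)
      (by rw [neg_nonpos]; positivity)
    rw [lineLength_zero] at h
    have h2 := (abs_le.1 (hsc (-(2 * |y| / k + 1)))).1
    have h3 : k * (|y| / k) ≤ k * ((0 - Real.sin 0 * Real.cos 0) / 2 -
        (-(2 * |y| / k + 1) - Real.sin (-(2 * |y| / k + 1)) *
        Real.cos (-(2 * |y| / k + 1))) / 2) := by
      refine mul_le_mul_of_nonneg_left ?_ hk.le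
      rw [Real.sin_zero, mul_div_assoc] at *; linarith
    rw [mul_div_cancel₀ _ hk.ne'] at h3
    change k * _ ≤ _ at h
    linarith [neg_abs_le y]

/-- Arclength as an order isomorphism from the first angle. -/
def lineIso : ℝ ≃o ℝ :=
  StrictMono.orderIsoOfSurjective _ (H.strictMono_lineLength ε d) (H.surjective_lineLength ε d)

/-- The first angle at arclength `s`. -/
def angleU (s : ℝ) : ℝ := (H.lineIso ε d).symm s

/-- The second angle at arclength `s`. -/
def angleV (s : ℝ) : ℝ := H.lineV ε d (H.angleU ε d s)

/-- The line on the ellipsoid, parametrized by arclength and continued through umbilic points. -/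
def path (s : ℝ) : E3 := param a b c (H.angleU ε d s) (H.angleV ε d s)

/-- The velocity of `path`. -/
def velocity (s : ℝ) : E3 :=
  ‖H.lineTangent ε d (H.angleU ε d s)‖⁻¹ • H.lineTangent ε d (H.angleU ε d s)

/-- The difference of the ellipsoidal coordinates along `path`. -/
def pathGap (s : ℝ) : ℝ := gap a b c (H.angleU ε d s) (H.angleV ε d s)

lemma angleU_lineLength (φ : ℝ) : H.angleU ε d (H.lineLength ε d φ) = φ :=
  (H.lineIso ε d).symm_apply_apply φ

lemma lineLength_angleU (s : ℝ) : H.lineLength ε d (H.angleU ε d s) = s :=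
  (H.lineIso ε d).apply_symm_apply s

lemma continuous_angleU : Continuous (H.angleU ε d) := (H.lineIso ε d).symm.continuous

lemma continuous_angleV : Continuous (H.angleV ε d) :=
  (H.continuous_lineV ε d).comp (H.continuous_angleU ε d)

lemma continuous_path : Continuous (H.path ε d) :=
  H.continuous_param (H.continuous_angleU ε d) (H.continuous_angleV ε d)

lemma continuous_pathGap : Continuous (H.pathGap ε d) :=
  Continuous.sub (f := fun s => quad (b ^ 2) (a ^ 2) (H.angleV ε d s))
    (g := fun s => quad (b ^ 2) (c ^ 2) (H.angleU ε d s))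
    ((continuous_quad _ _).comp (H.continuous_angleV ε d))
    ((continuous_quad _ _).comp (H.continuous_angleU ε d))

lemma path_mem (s : ℝ) : H.path ε d s ∈ ellipsoid a b c := H.param_mem _ _

variable {ε d}

lemma lineTangent_angleU_ne_zero {s : ℝ} (hs : H.pathGap ε d s ≠ 0) :
    H.lineTangent ε d (H.angleU ε d s) ≠ 0 := H.lineTangent_ne_zero ε d hs

lemma continuousAt_velocity {s : ℝ} (hs : H.pathGap ε d s ≠ 0) :
    ContinuousAt (H.velocity ε d) s := by
  have h1 : Continuous fun s => H.lineTangent ε d (H.angleU ε d s) :=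
    (H.continuous_lineTangent ε d).comp (H.continuous_angleU ε d)
  exact (h1.norm.continuousAt.inv₀ (norm_ne_zero_iff.2 (H.lineTangent_angleU_ne_zero hs))).smul
    h1.continuousAt

lemma hasDerivAt_path {s : ℝ} (hs : H.pathGap ε d s ≠ 0) :
    HasDerivAt (H.path ε d) (H.velocity ε d s) s := by
  have h1 : HasDerivAt (H.angleU ε d) _ s :=
    HasDerivAt.of_local_left_inverse (H.continuous_angleU ε d).continuousAt
      (H.hasDerivAt_lineLength ε d _) (norm_ne_zero_iff.2 (H.lineTangent_angleU_ne_zero hs))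
      (Eventually.of_forall (H.lineLength_angleU ε d))
  have h2 := (H.hasDerivAt_lineV ε d (H.angleU ε d s)).comp s h1
  refine (H.hasDerivAt_param h1 h2).congr_deriv ?_
  rw [velocity]
  generalize ‖H.lineTangent ε d (H.angleU ε d s)‖⁻¹ = r
  rw [lineTangent, smul_add, smul_smul, mul_comm r]
  rfl

lemma isUmbilic_path {s : ℝ} (hs : H.pathGap ε d s = 0) :
    IsUmbilic (ellipsoid a b c) (inwardNormal a b c) (H.path ε d s) := H.isUmbilic_param hs

lemma norm_velocity {s : ℝ} (hs : H.pathGap ε d s ≠ 0) : ‖H.velocity ε d s‖ = 1 := by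
  rw [velocity, norm_smul, norm_inv, norm_norm,
    inv_mul_cancel₀ (norm_ne_zero_iff.2 (H.lineTangent_angleU_ne_zero hs))]

/-- The equation `dσ(v) = ε dσ(u)` along the line. -/
lemma densV_mul_slope (φ : ℝ) : arcDensity (b ^ 2) (a ^ 2) (c ^ 2) (H.lineV ε d φ) *
    H.slope ε d φ = ε * arcDensity (b ^ 2) (c ^ 2) (a ^ 2) φ := by
  have := (H.nondegV.arcDensity_pos (H.lineV ε d φ)).ne'
  rw [slope]; field_simp

lemma velocity_eq (s : ℝ) : H.velocity ε d s =
    ‖H.lineTangent ε d (H.angleU ε d s)‖⁻¹ • paramU a b c (H.angleU ε d s) (H.angleV ε d s) +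
    (‖H.lineTangent ε d (H.angleU ε d s)‖⁻¹ * H.slope ε d (H.angleU ε d s)) •
      paramV a b c (H.angleU ε d s) (H.angleV ε d s) := by
  rw [velocity]
  generalize ‖H.lineTangent ε d (H.angleU ε d s)‖⁻¹ = r
  rw [lineTangent, smul_add, smul_smul]; rfl

/-- Away from the umbilic points, `path` is a geometric mean curvature line. -/
lemma isGMCLine_path (hε : ε ^ 2 = 1) {J : Set ℝ} {τ : ℝ} (hJ : IsOpen J) (hne : J.Nonempty)
    (hord : J.OrdConnected) (hgap : ∀ t ∈ J, H.pathGap ε d (t + τ) ≠ 0) :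
    IsGMCLine (ellipsoid a b c) (inwardNormal a b c) J (fun t => H.path ε d (t + τ)) := by
  have hder : ∀ t ∈ J, HasDerivAt (fun t => H.path ε d (t + τ)) (H.velocity ε d (t + τ)) t :=
    fun t ht => (H.hasDerivAt_path (hgap t ht)).comp_add_const t τ
  have hder' : ∀ t ∈ J, deriv (fun t => H.path ε d (t + τ)) t = H.velocity ε d (t + τ) :=
    fun t ht => (hder t ht).deriv
  refine ⟨hJ, hne, hord, ?_, ?_, fun t _ => H.path_mem ε d _, fun t ht =>
    H.gaussCurvature_param_pos (hgap t ht), fun t ht => H.not_isUmbilic_param (hgap t ht), ?_⟩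
  · rw [contDiffOn_one_iff_derivWithin hJ.uniqueDiffOn]
    refine ⟨fun t ht => (hder t ht).differentiableAt.differentiableWithinAt, ?_⟩
    have hc : ContinuousOn (fun t => H.velocity ε d (t + τ)) J := fun t ht => by
      have h1 : ContinuousAt (fun t => H.velocity ε d (t + τ)) t :=
        ContinuousAt.comp (g := H.velocity ε d) (H.continuousAt_velocity (hgap t ht)) (by fun_prop)
      exact h1.continuousWithinAt
    refine hc.congr fun t ht => ?_
    rw [derivWithin_of_isOpen hJ ht, hder' t ht]
  · intro t ht
    rw [hder' t ht, H.norm_velocity (hgap t ht)]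
  · intro t ht
    rw [hder' t ht]
    have hne0 : H.velocity ε d (t + τ) ≠ 0 := by
      rw [← norm_ne_zero_iff, H.norm_velocity (hgap t ht)]; exact one_ne_zero
    rw [H.velocity_eq] at hne0 ⊢
    refine (H.normalCurvature_eq_iff (hgap t ht) hne0).2 ?_
    have := H.densV_mul_slope (ε := ε) (d := d) (H.angleU ε d (t + τ))
    change arcDensity _ _ _ (H.angleV ε d (t + τ)) * _ = _ at this
    rw [mul_left_comm (arcDensity _ _ _ (H.angleV ε d (t + τ))), this]
    linear_combination -(arcDensity (b ^ 2) (c ^ 2) (a ^ 2) (H.angleU ε d (t + τ)) *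
      ‖H.lineTangent ε d (H.angleU ε d (t + τ))‖⁻¹) ^ 2 * hε

end Triaxial

namespace Triaxial

variable {a b c : ℝ} (H : Triaxial a b c) {ε d : ℝ}

/-! ### Geometric mean curvature lines are the lines `dσ(v) = ± dσ(u)` -/

include H in
lemma gap_ne_zero_of_line {J : Set ℝ} {γ : ℝ → E3}
    (hγ : IsGMCLine (ellipsoid a b c) (inwardNormal a b c) J γ) {t φ ψ : ℝ} (ht : t ∈ J)
    (h : γ t = param a b c φ ψ) : gap a b c φ ψ ≠ 0 := fun h0 =>
  hγ.not_umbilic t ht (h ▸ H.isUmbilic_param h0)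

include H in
/-- A geometric mean curvature line in the two angles. -/
lemma direction_of_line {J : Set ℝ} {γ : ℝ → E3}
    (hγ : IsGMCLine (ellipsoid a b c) (inwardNormal a b c) J γ) {t φ ψ α β : ℝ} (ht : t ∈ J)
    (h : γ t = param a b c φ ψ)
    (h' : deriv γ t = α • paramU a b c φ ψ + β • paramV a b c φ ψ) :
    (arcDensity (b ^ 2) (c ^ 2) (a ^ 2) φ * α) ^ 2 =
      (arcDensity (b ^ 2) (a ^ 2) (c ^ 2) ψ * β) ^ 2 := by
  have hne : α • paramU a b c φ ψ + β • paramV a b c φ ψ ≠ 0 := by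
    rw [← h', ← norm_ne_zero_iff, hγ.unitSpeed t ht]; exact one_ne_zero
  rw [← H.normalCurvature_eq_iff (H.gap_ne_zero_of_line hγ ht h) hne, ← h, ← h']
  exact hγ.normalCurvature_eq t ht

/-- Near a time where a geometric mean curvature line is tangent to `path`, they agree. -/
lemma eventually_eq_path {J : Set ℝ} {γ : ℝ → E3}
    (hγ : IsGMCLine (ellipsoid a b c) (inwardNormal a b c) J γ) (hε : ε ^ 2 = 1) {t τ : ℝ}
    (ht : t ∈ J) (h0 : γ t = H.path ε d (t + τ)) (h1 : deriv γ t = H.velocity ε d (t + τ)) :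
    ∀ᶠ s in 𝓝 t, γ s = H.path ε d (s + τ) := by
  have hJ : ∀ᶠ s in 𝓝 t, s ∈ J := hγ.isOpen.mem_nhds ht
  have hg := H.gap_ne_zero_of_line hγ ht h0
  obtain ⟨f, g, hf, hg', hft, hgt, hfg⟩ := H.exists_local_lift
    (hγ.contDiffOn.contDiffAt (hγ.isOpen.mem_nhds ht)) (hJ.mono hγ.mem) h0 hg
  have hfd : ∀ᶠ s in 𝓝 t, HasDerivAt f (deriv f s) s :=
    (hf.eventually (by simp)).mono fun s hs => (hs.differentiableAt one_ne_zero).hasDerivAt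
  have hgd : ∀ᶠ s in 𝓝 t, HasDerivAt g (deriv g s) s :=
    (hg'.eventually (by simp)).mono fun s hs => (hs.differentiableAt one_ne_zero).hasDerivAt
  have hfc : ContinuousAt (deriv f) t := (hf.derivWithin (m := 0) (by simp)).continuousAt
  have hgc : ContinuousAt (deriv g) t := (hg'.derivWithin (m := 0) (by simp)).continuousAt
  have hγd : ∀ᶠ s in 𝓝 t, deriv γ s =
      deriv f s • paramU a b c (f s) (g s) + deriv g s • paramV a b c (f s) (g s) := by
    filter_upwards [hfd, hgd, hfg.eventually_nhds] with s h2 h3 h4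
    exact ((H.hasDerivAt_param h2 h3).congr_of_eventuallyEq h4).deriv
  set F := arcDensity (b ^ 2) (c ^ 2) (a ^ 2) with hF
  set G := arcDensity (b ^ 2) (a ^ 2) (c ^ 2) with hG
  have hr : 0 < ‖H.lineTangent ε d (H.angleU ε d (t + τ))‖ :=
    norm_pos_iff.2 (H.lineTangent_angleU_ne_zero hg)
  -- The lift starts with the angular velocity of `path`, because the two partial derivatives are
  -- independent here.
  have hstart : deriv f t = ‖H.lineTangent ε d (H.angleU ε d (t + τ))‖⁻¹ ∧ deriv g t =
      ‖H.lineTangent ε d (H.angleU ε d (t + τ))‖⁻¹ * H.slope ε d (H.angleU ε d (t + τ)) := by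
    refine H.comb_injective hg ?_
    rw [← H.velocity_eq, ← h1, hγd.self_of_nhds, hft, hgt]
  -- The curvature condition equates only the squares of the `σ`-velocities. Their signs at `t`
  -- persist nearby and select the branch with the given `ε`.
  have hfpos : ∀ᶠ s in 𝓝 t, 0 < deriv f s :=
    hfc.eventually_const_lt (by rw [hstart.1]; positivity)
  have hgpos : ∀ᶠ s in 𝓝 t, 0 < ε * (G (g s) * deriv g s) := by
    have hc : ContinuousAt (fun s => ε * (G (g s) * deriv g s)) t :=
      continuousAt_const.mul
        ((H.nondegV.continuous_arcDensity.continuousAt.comp hg'.continuousAt).mul hgc)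
    refine hc.eventually_const_lt ?_
    change 0 < ε * (G (g t) * deriv g t)
    have h2 := H.densV_mul_slope (ε := ε) (d := d) (H.angleU ε d (t + τ))
    change G (H.angleV ε d (t + τ)) * _ = ε * F _ at h2
    rw [hstart.2, hgt, mul_left_comm (G _), h2,
      show ∀ r x : ℝ, ε * (r * (ε * x)) = ε ^ 2 * (r * x) from fun r x => by ring, hε, one_mul]
    have := H.nondegU.arcDensity_pos (H.angleU ε d (t + τ))
    positivity
  have hline : ∀ᶠ s in 𝓝 t, F (f s) * deriv f s = ε * (G (g s) * deriv g s) := by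
    filter_upwards [hJ, hfg, hγd, hfpos, hgpos] with s h2 h3 h4 h5 h6
    have h7 := H.direction_of_line hγ h2 h3 h4
    have h8 := H.nondegU.arcDensity_pos (f s)
    refine (pow_left_inj₀ (by positivity) h6.le two_ne_zero).1 ?_
    rw [h7, mul_pow ε, hε, one_mul]
  -- Integration of the branch equation: `σ(v) - ε σ(u)` is locally constant, and its value at `t`
  -- is `d`.
  have hconst : ∀ᶠ s in 𝓝 t, arcLength (b ^ 2) (a ^ 2) (c ^ 2) (g s) =
      ε * arcLength (b ^ 2) (c ^ 2) (a ^ 2) (f s) + d := by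
    have h2 : ∀ᶠ s in 𝓝 t, HasDerivAt (fun s => arcLength (b ^ 2) (a ^ 2) (c ^ 2) (g s) -
        ε * arcLength (b ^ 2) (c ^ 2) (a ^ 2) (f s)) 0 s := by
      filter_upwards [hfd, hgd, hline] with s h3 h4 h5
      refine (((H.nondegV.hasDerivAt_arcLength (g s)).comp s h4).sub
        (((H.nondegU.hasDerivAt_arcLength (f s)).comp s h3).const_mul ε)).congr_deriv ?_
      rw [← hF, ← hG, h5]
      linear_combination -(G (g s) * deriv g s) * hε
    filter_upwards [eventually_eq_of_hasDerivAt_zero h2] with s h3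
    have h4 := H.arcLength_lineV ε d (H.angleU ε d (t + τ))
    change arcLength _ _ _ (H.angleV ε d (t + τ)) = _ at h4
    rw [hft, hgt, h4] at h3
    linarith
  have hlineV : ∀ᶠ s in 𝓝 t, H.lineV ε d (f s) = g s := hconst.mono fun s hs => H.lineV_eq hs
  -- The lift follows the straight line, and unit speed fixes its parametrization.
  have hlen : ∀ᶠ s in 𝓝 t, H.lineLength ε d (f s) = s + τ := by
    have h2 : ∀ᶠ s in 𝓝 t, HasDerivAt (fun s => H.lineLength ε d (f s) - s) 0 s := by
      filter_upwards [hJ, hfd, hlineV, hγd, hfpos, hline] with s h3 h4 h5 h6 h7 h8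
      refine (((H.hasDerivAt_lineLength ε d (f s)).comp s h4).sub (hasDerivAt_id s)).congr_deriv ?_
      have h9 : deriv γ s = deriv f s • H.lineTangent ε d (f s) := by
        have hGpos := H.nondegV.arcDensity_pos (g s)
        have h10 : deriv g s = deriv f s * H.slope ε d (f s) := by
          rw [slope, h5, ← hF, ← hG, mul_div_assoc', eq_div_iff hGpos.ne']
          linear_combination -ε * h8 - (G (g s) * deriv g s) * hε
        rw [h6, lineTangent, h5, smul_add, smul_smul, h10]
      have h10 := hγ.unitSpeed s h3
      rw [h9, norm_smul, Real.norm_of_nonneg h7.le] at h10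
      linarith
    filter_upwards [eventually_eq_of_hasDerivAt_zero h2] with s h3
    rw [hft, H.lineLength_angleU] at h3
    linarith
  filter_upwards [hfg, hlineV, hlen] with s h2 h3 h4
  have h5 : H.angleU ε d (s + τ) = f s := by rw [← h4, H.angleU_lineLength]
  rw [h2, path, angleV, h5, h3]

/-- A geometric mean curvature line that is tangent to `path` agrees with it. -/
lemma eqOn_path {J : Set ℝ} {γ : ℝ → E3}
    (hγ : IsGMCLine (ellipsoid a b c) (inwardNormal a b c) J γ) (hε : ε ^ 2 = 1) {t₀ τ : ℝ}
    (ht₀ : t₀ ∈ J) (h0 : γ t₀ = H.path ε d (t₀ + τ))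
    (h1 : deriv γ t₀ = H.velocity ε d (t₀ + τ)) {t : ℝ} (ht : t ∈ J) :
    γ t = H.path ε d (t + τ) := by
  -- Connectedness of `J`. Velocities belong to the condition because two lines cross at each point,
  -- each with two orientations.
  set S := {t | t ∈ J ∧ γ t = H.path ε d (t + τ) ∧ deriv γ t = H.velocity ε d (t + τ)} with hS
  have hopen : IsOpen S := by
    rw [isOpen_iff_mem_nhds]
    rintro s ⟨hs, h2, h3⟩
    filter_upwards [hγ.isOpen.mem_nhds hs, (H.eventually_eq_path hγ hε hs h2 h3).eventually_nhds]
      with r hr h4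
    refine ⟨hr, h4.self_of_nhds, ?_⟩
    have hg := H.gap_ne_zero_of_line hγ hr h4.self_of_nhds
    exact (((H.hasDerivAt_path hg).comp_add_const r τ).congr_of_eventuallyEq h4).deriv
  have hclosed : closure S ∩ J ⊆ S := by
    rintro s ⟨hs, hsJ⟩
    obtain ⟨u, hu, hlim⟩ := mem_closure_iff_seq_limit.1 hs
    have hnhds := hγ.isOpen.mem_nhds hsJ
    have hadd : Tendsto (fun n => u n + τ) atTop (𝓝 (s + τ)) := hlim.add_const τ
    have h2 : γ s = H.path ε d (s + τ) := by
      refine tendsto_nhds_unique ((hγ.contDiffOn.continuousOn.continuousAt hnhds).tendsto.comp hlim)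
        (((H.continuous_path ε d).continuousAt.tendsto.comp hadd).congr fun n => ?_)
      exact (hu n).2.1.symm
    refine ⟨hsJ, h2, ?_⟩
    have hg := H.gap_ne_zero_of_line hγ hsJ h2
    have h3 : ContinuousAt (deriv γ) s :=
      (hγ.contDiffOn.continuousOn_deriv_of_isOpen hγ.isOpen le_rfl).continuousAt hnhds
    refine tendsto_nhds_unique (h3.tendsto.comp hlim)
      (((H.continuousAt_velocity hg).tendsto.comp hadd).congr fun n => ?_)
    exact (hu n).2.2.symm
  exact (hγ.ordConnected.isPreconnected.subset_of_closure_inter_subset hopen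
    ⟨t₀, ht₀, ht₀, h0, h1⟩ hclosed ht).2.1

/-- Every tangent direction of geometric mean curvature is that of some `path`. -/
lemma exists_path_of_line {J : Set ℝ} {γ : ℝ → E3}
    (hγ : IsGMCLine (ellipsoid a b c) (inwardNormal a b c) J γ) :
    ∃ ε d τ : ℝ, ε ^ 2 = 1 ∧ ∀ t ∈ J, γ t = H.path ε d (t + τ) := by
  obtain ⟨t, ht⟩ := hγ.nonempty
  have hd : HasDerivAt γ (deriv γ t) t :=
    ((hγ.contDiffOn.contDiffAt (hγ.isOpen.mem_nhds ht)).differentiableAt one_ne_zero).hasDerivAt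
  have hunit := hγ.unitSpeed t ht
  -- A `path` moves with increasing first angle, so only a lift with `α > 0` can be matched with
  -- one.
  suffices h : ∃ φ ψ α β : ℝ, γ t = param a b c φ ψ ∧ 0 < α ∧
      deriv γ t = α • paramU a b c φ ψ + β • paramV a b c φ ψ by
    obtain ⟨φ, ψ, α, β, h0, hα, h1⟩ := h
    have hG := H.nondegV.arcDensity_pos ψ
    obtain ⟨ε, hε, h2⟩ : ∃ ε : ℝ, ε ^ 2 = 1 ∧ arcDensity (b ^ 2) (a ^ 2) (c ^ 2) ψ * β =
        ε * (arcDensity (b ^ 2) (c ^ 2) (a ^ 2) φ * α) := by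
      rcases sq_eq_sq_iff_eq_or_eq_neg.1 (H.direction_of_line hγ ht h0 h1) with h | h
      · exact ⟨1, by norm_num, by rw [h, one_mul]⟩
      · exact ⟨-1, by norm_num, by rw [h]; ring⟩
    set d := arcLength (b ^ 2) (a ^ 2) (c ^ 2) ψ - ε * arcLength (b ^ 2) (c ^ 2) (a ^ 2) φ with hd
    have hV : H.lineV ε d φ = ψ := H.lineV_eq (by rw [hd]; ring)
    have hU : H.angleU ε d (t + (H.lineLength ε d φ - t)) = φ := by
      rw [add_sub_cancel, H.angleU_lineLength]
    have h3 : deriv γ t = α • H.lineTangent ε d φ := by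
      have : β = α * H.slope ε d φ := by
        rw [slope, hV, mul_div_assoc', eq_div_iff hG.ne']
        linear_combination h2
      rw [h1, lineTangent, hV, smul_add, smul_smul, this]
    have h4 : α = ‖H.lineTangent ε d φ‖⁻¹ := by
      rw [h3, norm_smul, Real.norm_of_nonneg hα.le] at hunit
      exact eq_inv_of_mul_eq_one_left hunit
    refine ⟨ε, d, H.lineLength ε d φ - t, hε, fun s hs => H.eqOn_path hγ hε ht ?_ ?_ hs⟩
    · rw [path, angleV, hU, hV, h0]
    · rw [velocity, hU, h3, ← h4]
  obtain ⟨φ, ψ, h0⟩ := H.exists_param_eq (hγ.mem t ht)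
  -- The quadratic form is constantly `1` along `γ`; its derivative gives tangency.
  have htan : inner ℝ (halfGradient a b c (param a b c φ ψ)) (deriv γ t) = 0 := by
    have h2 : HasDerivAt (fun s => inner ℝ (halfGradient a b c (γ s)) (γ s))
        (inner ℝ (halfGradient a b c (γ t)) (deriv γ t) +
          inner ℝ (halfGradient a b c (deriv γ t)) (γ t)) t :=
      HasDerivAt.inner ℝ ((halfGradientL a b c).hasFDerivAt.comp_hasDerivAt t hd) hd
    have h3 : (fun s => inner ℝ (halfGradient a b c (γ s)) (γ s)) =ᶠ[𝓝 t] fun _ => (1 : ℝ) := by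
      filter_upwards [hγ.isOpen.mem_nhds ht] with s hs
      exact inner_halfGradient_self_of_mem (hγ.mem s hs)
    have h4 := h2.unique ((hasDerivAt_const t (1 : ℝ)).congr_of_eventuallyEq h3)
    rw [inner_halfGradient_comm a b c (deriv γ t)] at h4
    rw [h0]; linarith
  obtain ⟨α, β, h1⟩ := H.exists_eq_add_smul (H.gap_ne_zero_of_line hγ ht h0.symm) htan
  rcases lt_trichotomy α 0 with hα | hα | hα
  · refine ⟨-φ, -ψ, -α, -β, by rw [param_neg, h0], by linarith, ?_⟩
    rw [paramU_neg, paramV_neg, neg_smul_neg, neg_smul_neg, h1]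
  · exfalso
    have h2 := H.direction_of_line hγ ht h0.symm h1
    have h3 : β = 0 := by
      have := (H.nondegV.arcDensity_pos ψ).ne'
      rw [hα, mul_zero, zero_pow two_ne_zero, eq_comm, pow_eq_zero_iff two_ne_zero] at h2
      exact (mul_eq_zero.1 h2).resolve_left this
    rw [h1, hα, h3] at hunit
    simp at hunit
  · exact ⟨φ, ψ, α, β, h0.symm, hα, h1⟩

/-- A complete geometric mean curvature line is a maximal piece of some `path` between umbilic
points. -/
lemma exists_path_of_completeLine {J : Set ℝ} {γ : ℝ → E3}
    (hγ : IsCompleteGMCLine (ellipsoid a b c) (inwardNormal a b c) J γ) :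
    ∃ ε d τ : ℝ, ε ^ 2 = 1 ∧ (∀ t ∈ J, γ t = H.path ε d (t + τ)) ∧
      ∀ t ∈ closure J, t ∉ J → H.pathGap ε d (t + τ) = 0 := by
  obtain ⟨ε, d, τ, hε, h⟩ := H.exists_path_of_line hγ.isLine
  have hg : ∀ t ∈ J, H.pathGap ε d (t + τ) ≠ 0 := fun t ht =>
    H.gap_ne_zero_of_line hγ.isLine ht (h t ht)
  refine ⟨ε, d, τ, hε, h, fun t ht htJ => ?_⟩
  -- At a boundary time without umbilic point, `path` would continue the line over a ball around
  -- that time, against maximality.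
  by_contra h0
  have hcont : Continuous fun s => H.pathGap ε d (s + τ) :=
    (H.continuous_pathGap ε d).comp (continuous_id.add continuous_const)
  obtain ⟨r, hr, hball⟩ := Metric.eventually_nhds_iff_ball.1
    (hcont.continuousAt.eventually_ne h0)
  obtain ⟨s, hsJ, hs⟩ := Metric.mem_closure_iff.1 ht r hr
  have hs' : s ∈ Metric.ball t r := by rwa [Metric.mem_ball, dist_comm]
  have hline : IsGMCLine (ellipsoid a b c) (inwardNormal a b c) (J ∪ Metric.ball t r)
      (fun s => H.path ε d (s + τ)) := by
    refine H.isGMCLine_path hε (hγ.isLine.isOpen.union Metric.isOpen_ball)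
      (hγ.isLine.nonempty.mono subset_union_left) ?_ ?_
    · exact (IsPreconnected.union s hsJ hs' hγ.isLine.ordConnected.isPreconnected
        (convex_ball t r).isPreconnected).ordConnected
    · rintro x (hx | hx)
      exacts [hg x hx, hball x hx]
  have := hγ.maximal _ _ hline subset_union_left h
  exact htJ (this ▸ Or.inr (Metric.mem_ball_self hr))

end Triaxial

/-! ### Ends of a line -/

section Ends

variable {J : Set ℝ} {γ : ℝ → E3}

lemma csSup_notMem_of_isOpen (hJ : IsOpen J) (hb : BddAbove J) : sSup J ∉ J := fun h => by
  obtain ⟨r, hr, hball⟩ := Metric.isOpen_iff.1 hJ _ h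
  have h1 : sSup J + r / 2 ∈ J := hball (by
    rw [Metric.mem_ball, Real.dist_eq, add_sub_cancel_left, abs_of_pos (by positivity)]; linarith)
  linarith [le_csSup hb h1]

lemma csInf_notMem_of_isOpen (hJ : IsOpen J) (hb : BddBelow J) : sInf J ∉ J := fun h => by
  obtain ⟨r, hr, hball⟩ := Metric.isOpen_iff.1 hJ _ h
  have h1 : sInf J - r / 2 ∈ J := hball (by
    rw [Metric.mem_ball, Real.dist_eq, sub_sub_cancel_left, abs_neg, abs_of_pos (by positivity)]
    linarith)
  linarith [csInf_le hb h1]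

lemma tendsto_coe_atTop_csSup (hne : J.Nonempty) (hb : BddAbove J) :
    Tendsto (fun t : J => (t : ℝ)) atTop (𝓝 (sSup J)) :=
  tendsto_atTop_isLUB (fun _ _ h => h) (by simpa using isLUB_csSup hne hb)

lemma tendsto_coe_atBot_csInf (hne : J.Nonempty) (hb : BddBelow J) :
    Tendsto (fun t : J => (t : ℝ)) atBot (𝓝 (sInf J)) :=
  tendsto_atBot_isGLB (fun _ _ h => h) (by simpa using isGLB_csInf hne hb)

lemma eq_univ_of_unbounded (hJ : J.OrdConnected) (hT : ¬ BddAbove J) (hB : ¬ BddBelow J) :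
    J = univ := by
  refine eq_univ_of_forall fun t => ?_
  obtain ⟨y, hy, hty⟩ := not_bddAbove_iff.1 hT t
  obtain ⟨x, hx, hxt⟩ := not_bddBelow_iff.1 hB t
  exact hJ.out hx hy ⟨hxt.le, hty.le⟩

lemma mapClusterPt_atTop (hJ : J.OrdConnected) (hne : J.Nonempty) (hT : ¬ BddAbove J) {x : E3}
    (h : ∀ V ∈ 𝓝 x, ∀ M : ℝ, ∃ s, M ≤ s ∧ γ s ∈ V) :
    MapClusterPt x atTop (fun t : J => γ t) := by
  have := hne.to_subtype
  rw [mapClusterPt_iff_frequently]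
  intro V hV
  rw [frequently_atTop]
  intro t
  obtain ⟨s, hs, hsV⟩ := h V hV t
  obtain ⟨y, hy, hsy⟩ := not_bddAbove_iff.1 hT s
  exact ⟨⟨s, hJ.out t.2 hy ⟨hs, hsy.le⟩⟩, hs, hsV⟩

lemma mapClusterPt_atBot (hJ : J.OrdConnected) (hne : J.Nonempty) (hB : ¬ BddBelow J) {x : E3}
    (h : ∀ V ∈ 𝓝 x, ∀ M : ℝ, ∃ s, s ≤ M ∧ γ s ∈ V) :
    MapClusterPt x atBot (fun t : J => γ t) := by
  have := hne.to_subtype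
  rw [mapClusterPt_iff_frequently]
  intro V hV
  rw [frequently_atBot]
  intro t
  obtain ⟨s, hs, hsV⟩ := h V hV t
  obtain ⟨y, hy, hys⟩ := not_bddBelow_iff.1 hB s
  exact ⟨⟨s, hJ.out hy t.2 ⟨hys.le, hs⟩⟩, hs, hsV⟩

/-- Along `t + n T` the curve is constant, so its limit is the value at `t`. -/
lemma eq_of_tendsto_of_periodic {T : ℝ} (hper : Function.Periodic γ T) {l : Filter ℝ}
    {p : E3} (hl : Tendsto γ l (𝓝 p)) (t : ℝ)
    (hu : Tendsto (fun n : ℕ => t + n * T) atTop l) : γ t = p := by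
  have h1 := hl.comp hu
  refine tendsto_nhds_unique (tendsto_const_nhds.congr fun n => ?_) h1
  exact ((hper.nat_mul n) t).symm

/-- A closed line without umbilic points does not tend to an umbilic point. -/
lemma not_isUmbilicSeparatrix_of_isClosedLine {S : Set E3} {N : E3 → E3}
    (hγ : IsGMCLine S N J γ) (hc : IsClosedLine J γ) : ¬ IsUmbilicSeparatrix S N J γ := by
  obtain ⟨rfl, T, hT, hper⟩ := hc
  rintro ⟨p, hp, h | h⟩
  · have h1 : Tendsto γ atTop (𝓝 p) :=
      h.comp (tendsto_atTop_atTop.2 fun t => ⟨t.1, fun s hs => hs⟩ :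
        Tendsto (fun s : ℝ => (⟨s, mem_univ s⟩ : (univ : Set ℝ))) atTop atTop)
    have h2 := eq_of_tendsto_of_periodic hper h1 0 (tendsto_atTop_add_const_left _ _
      (tendsto_natCast_atTop_atTop.atTop_mul_const hT))
    exact hγ.not_umbilic 0 (mem_univ _) (h2 ▸ hp)
  · have h1 : Tendsto γ atBot (𝓝 p) :=
      h.comp (tendsto_atBot_atBot.2 fun t => ⟨t.1, fun s hs => hs⟩ :
        Tendsto (fun s : ℝ => (⟨s, mem_univ s⟩ : (univ : Set ℝ))) atBot atBot)
    have h2 := eq_of_tendsto_of_periodic hper.neg h1 0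
      (tendsto_atBot_add_const_left _ _
        (tendsto_natCast_atTop_atTop.atTop_mul_const_of_neg (neg_lt_zero.2 hT)))
    exact hγ.not_umbilic 0 (mem_univ _) (h2 ▸ hp)

end Ends

/-! ### Translations of the two angles -/

lemma param_add_two_pi (a b c φ ψ : ℝ) (n m : ℤ) :
    param a b c (φ + n * (2 * Real.pi)) (ψ + m * (2 * Real.pi)) = param a b c φ ψ := by
  simp [param, radU, radV, quad]

lemma paramU_add_two_pi (a b c φ ψ : ℝ) (n m : ℤ) :
    paramU a b c (φ + n * (2 * Real.pi)) (ψ + m * (2 * Real.pi)) = paramU a b c φ ψ := by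
  simp [paramU, radU, radV, quad]

lemma paramV_add_two_pi (a b c φ ψ : ℝ) (n m : ℤ) :
    paramV a b c (φ + n * (2 * Real.pi)) (ψ + m * (2 * Real.pi)) = paramV a b c φ ψ := by
  simp [paramV, radU, radV, quad]

lemma arcDensity_add_two_pi (B C D x : ℝ) (n : ℤ) :
    arcDensity B C D (x + n * (2 * Real.pi)) = arcDensity B C D x := by
  simp [arcDensity, quad]

/-- Large multiples of a number come close to the multiples of another one. -/
lemma exists_large_multiple_near {x y η : ℝ} (hy : 0 < y) (hη : 0 < η) (N : ℕ) :
    ∃ n : ℕ, N ≤ n ∧ ∃ m : ℤ, |n * x - m * y| < η := by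
  -- Dirichlet's theorem gives some `k > 0` with `k x / y` within `1 / (K + 1)` of an integer.
  -- Multiplying by `N + 1` makes the multiple large, and `K` is chosen so that the enlarged error
  -- stays below `η`.
  obtain ⟨K, hK⟩ := exists_nat_gt ((N + 1) * y / η)
  have hK0 : (0 : ℝ) < K := lt_of_le_of_lt (by positivity) hK
  obtain ⟨k, hk0, -, hk⟩ := Real.exists_nat_abs_mul_sub_round_le (x / y) (Nat.cast_pos.1 hK0)
  refine ⟨(N + 1) * k, by nlinarith, (N + 1) * round (k * (x / y)), ?_⟩
  have h1 : (((N + 1) * k : ℕ) : ℝ) * x - (((N + 1) * round (k * (x / y)) : ℤ) : ℝ) * y =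
      (N + 1) * y * (k * (x / y) - round (k * (x / y))) := by
    push_cast; field_simp
  rw [h1, abs_mul, abs_of_pos (by positivity)]
  calc _ ≤ (N + 1) * y * (1 / (K + 1)) := by gcongr
    _ < η := by
      rw [mul_one_div, div_lt_iff₀ (by positivity)]
      rw [div_lt_iff₀ hη] at hK
      linarith

namespace Triaxial

variable {a b c : ℝ} (H : Triaxial a b c) {ε d : ℝ}

/-- Full turns have `σ`-lengths `4 S₁` and `4 S₂`. After `n` turns of `φ`, compared with `m` turns
of `ψ`, the line returns up to the defect `ε n 4 S₁ - m 4 S₂`. -/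
lemma lineV_add_two_pi (φ : ℝ) (n m : ℤ) : H.lineV ε d (φ + n * (2 * Real.pi)) =
    H.nondegV.arcIso.symm (arcLength (b ^ 2) (a ^ 2) (c ^ 2) (H.lineV ε d φ) +
      (ε * (n * (4 * S₁ a b c)) - m * (4 * S₂ a b c))) + m * (2 * Real.pi) := by
  have h1 := H.nondegU.arcLength_add_int_mul_pi φ (2 * n)
  have h2 := H.nondegV.arcIso_symm_add (arcLength (b ^ 2) (a ^ 2) (c ^ 2) (H.lineV ε d φ) +
      (ε * (n * (4 * S₁ a b c)) - m * (4 * S₂ a b c))) (2 * m)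
  rw [← H.S₁_eq] at h1
  rw [← H.S₂_eq] at h2
  push_cast at h1 h2
  rw [show φ + n * (2 * Real.pi) = φ + 2 * n * Real.pi by ring,
    show ∀ x : ℝ, x + m * (2 * Real.pi) = x + 2 * m * Real.pi from fun x => by ring, ← h2, lineV,
    h1, arcLength_lineV]
  congr 1; ring

/-- If `σ`-translations nearly agree, then `path` nearly returns to a given point. -/
lemma exists_delta (φ ψ : ℝ) {V : Set E3} (hV : V ∈ 𝓝 (param a b c φ ψ)) :
    ∃ η > 0, ∀ δ : ℝ, |δ| < η → param a b c φ
      (H.nondegV.arcIso.symm (arcLength (b ^ 2) (a ^ 2) (c ^ 2) ψ + δ)) ∈ V := by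
  have hc : Continuous fun δ : ℝ => param a b c φ
      (H.nondegV.arcIso.symm (arcLength (b ^ 2) (a ^ 2) (c ^ 2) ψ + δ)) :=
    H.continuous_param continuous_const
      (H.nondegV.continuous_arcIso_symm.comp (continuous_const.add continuous_id))
  have h1 : ∀ᶠ δ : ℝ in 𝓝 0, param a b c φ
      (H.nondegV.arcIso.symm (arcLength (b ^ 2) (a ^ 2) (c ^ 2) ψ + δ)) ∈ V :=
    hc.continuousAt.eventually_mem (by simpa using hV)
  obtain ⟨η, hη, h2⟩ := Metric.eventually_nhds_iff.1 h1
  exact ⟨η, hη, fun δ hδ => h2 (by simpa using hδ)⟩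

lemma path_lineLength (φ : ℝ) :
    H.path ε d (H.lineLength ε d φ) = param a b c φ (H.lineV ε d φ) := by
  rw [path, angleV, H.angleU_lineLength]

/-- By Dirichlet approximation the defect can be made small after arbitrarily many turns, for
rational and irrational ratios alike. The sign `κ` chooses the end of the line. -/
lemma exists_path_mem (hε : ε ^ 2 = 1) (s : ℝ) {V : Set E3} (hV : V ∈ 𝓝 (H.path ε d s)) (N : ℕ)
    {κ : ℤ} (hκ : κ ^ 2 = 1) :
    ∃ n : ℕ, N ≤ n ∧
      H.path ε d (H.lineLength ε d (H.angleU ε d s + (κ * n : ℤ) * (2 * Real.pi))) ∈ V := by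
  obtain ⟨η, hη, h1⟩ := H.exists_delta (H.angleU ε d s) (H.angleV ε d s) hV
  obtain ⟨n, hn, m, hm⟩ := exists_large_multiple_near (x := 4 * S₁ a b c)
    (mul_pos four_pos H.S₂_pos) hη N
  obtain ⟨e, rfl, he⟩ : ∃ e : ℤ, (e : ℝ) = ε ∧ e ^ 2 = 1 := by
    rcases sq_eq_one_iff.1 hε with h | h
    · exact ⟨1, by simp [h], by norm_num⟩
    · exact ⟨-1, by simp [h], by norm_num⟩
  refine ⟨n, hn, ?_⟩
  -- With `e κ m` turns of `ψ` the defect is `± (n 4 S₁ - m 4 S₂)`.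
  rw [H.path_lineLength, H.lineV_add_two_pi _ _ (e * κ * m), param_add_two_pi]
  refine h1 _ ?_
  have h2 : (e : ℝ) * (((κ * n : ℤ) : ℝ) * (4 * S₁ a b c)) - ((e * κ * m : ℤ) : ℝ) *
      (4 * S₂ a b c) = (e * κ : ℤ) * (n * (4 * S₁ a b c) - m * (4 * S₂ a b c)) := by
    push_cast; ring
  have h3 : |((e * κ : ℤ) : ℝ)| = 1 := by
    rw [← sq_eq_sq₀ (abs_nonneg _) zero_le_one, sq_abs, one_pow]
    exact_mod_cast (by rw [mul_pow, he, hκ, one_mul] : (e * κ) ^ 2 = 1)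
  rw [h2, abs_mul, h3, one_mul]
  exact hm

lemma path_returns_above (hε : ε ^ 2 = 1) (s : ℝ) {V : Set E3} (hV : V ∈ 𝓝 (H.path ε d s))
    (M : ℝ) : ∃ r, M ≤ r ∧ H.path ε d r ∈ V := by
  obtain ⟨N, hN⟩ := exists_nat_gt (H.angleU ε d M - H.angleU ε d s)
  obtain ⟨n, hn, h⟩ := H.exists_path_mem hε s hV N (κ := 1) (by norm_num)
  refine ⟨_, ?_, h⟩
  rw [← H.lineLength_angleU ε d M]
  refine (H.strictMono_lineLength ε d).monotone ?_
  have h1 : (N : ℝ) ≤ n := by exact_mod_cast hn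
  push_cast
  nlinarith [Real.pi_gt_three, (Nat.cast_nonneg n : (0 : ℝ) ≤ n)]

lemma path_returns_below (hε : ε ^ 2 = 1) (s : ℝ) {V : Set E3} (hV : V ∈ 𝓝 (H.path ε d s))
    (M : ℝ) : ∃ r, r ≤ M ∧ H.path ε d r ∈ V := by
  obtain ⟨N, hN⟩ := exists_nat_gt (H.angleU ε d s - H.angleU ε d M)
  obtain ⟨n, hn, h⟩ := H.exists_path_mem hε s hV N (κ := -1) (by norm_num)
  refine ⟨_, ?_, h⟩
  rw [← H.lineLength_angleU ε d M]
  refine (H.strictMono_lineLength ε d).monotone ?_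
  have h1 : (N : ℝ) ≤ n := by exact_mod_cast hn
  push_cast
  nlinarith [Real.pi_gt_three, (Nat.cast_nonneg n : (0 : ℝ) ≤ n)]

/-- For an irrational ratio a line meets at most one umbilic point. -/
lemma pathGap_unique (hρ : Irrational (rho a b c)) (hε : ε ^ 2 = 1) {s₁ s₂ : ℝ}
    (h₁ : H.pathGap ε d s₁ = 0) (h₂ : H.pathGap ε d s₂ = 0) : s₁ = s₂ := by
  by_contra hne
  have hS₁ := H.S₁_pos.ne'
  have hS₂ := H.S₂_pos.ne'
  -- In `σ`-coordinates the umbilic points are the lattice points `(2n S₁, 2m S₂)`; two of them on a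
  -- line of slope `±1` make the ratio rational.
  have key : ∀ s, H.pathGap ε d s = 0 → ∃ n m : ℤ, H.angleU ε d s = n * Real.pi ∧
      (m : ℝ) * (2 * S₂ a b c) = ε * (n * (2 * S₁ a b c)) + d := by
    intro s hs
    obtain ⟨hφ, hψ⟩ := (H.gap_eq_zero_iff _ _).1 hs
    obtain ⟨n, hn⟩ := Real.sin_eq_zero_iff.1 hφ
    obtain ⟨m, hm⟩ := Real.sin_eq_zero_iff.1 hψ
    refine ⟨n, m, hn.symm, ?_⟩
    have h3 := H.arcLength_lineV ε d (H.angleU ε d s)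
    change arcLength _ _ _ (H.angleV ε d s) = _ at h3
    rwa [← hm, ← hn, H.nondegU.arcLength_int_mul_pi, H.nondegV.arcLength_int_mul_pi, ← H.S₁_eq,
      ← H.S₂_eq] at h3
  obtain ⟨n₁, m₁, hn₁, hm₁⟩ := key s₁ h₁
  obtain ⟨n₂, m₂, hn₂, hm₂⟩ := key s₂ h₂
  have hn : (n₁ : ℝ) - n₂ ≠ 0 := by
    intro h0
    apply hne
    rw [← H.lineLength_angleU ε d s₁, ← H.lineLength_angleU ε d s₂, hn₁, hn₂, sub_eq_zero.1 h0]
  have h3 : ((m₁ : ℝ) - m₂) * S₂ a b c = ε * ((n₁ - n₂) * S₁ a b c) := by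
    linear_combination (hm₁ - hm₂) / 2
  have hε0 : ε ≠ 0 := by rintro rfl; norm_num at hε
  have hm : (m₁ : ℝ) - m₂ ≠ 0 := by
    intro h0
    rw [h0, zero_mul] at h3
    exact mul_ne_zero hε0 (mul_ne_zero hn hS₁) h3.symm
  have h4 : rho a b c = ε * ((n₁ - n₂) / (m₁ - m₂)) := by
    rw [rho]; field_simp; linear_combination h3
  rcases sq_eq_one_iff.1 hε with h | h
  · exact hρ ⟨((n₁ - n₂ : ℤ) : ℚ) / ((m₁ - m₂ : ℤ) : ℚ), by rw [h4, h]; push_cast; ring⟩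
  · exact hρ ⟨-(((n₁ - n₂ : ℤ) : ℚ) / ((m₁ - m₂ : ℤ) : ℚ)), by rw [h4, h]; push_cast; ring⟩

/-- For an irrational ratio every line accumulates at an umbilic point. -/
lemma umbilic_mem_closure_range_path (hρ : Irrational (rho a b c)) (hε : ε ^ 2 = 1) :
    param a b c 0 0 ∈ closure (range (H.path ε d)) := by
  rw [mem_closure_iff_nhds]
  intro V hV
  obtain ⟨η, hη, h1⟩ := H.exists_delta 0 0 hV
  have hε0 : ε ≠ 0 := by rintro rfl; norm_num at hε
  have hirr : Irrational (ε * (4 * S₁ a b c) / (4 * S₂ a b c)) := by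
    have h2 : ε * (4 * S₁ a b c) / (4 * S₂ a b c) = ε * (rho a b c)⁻¹ := by
      have := H.S₂_pos.ne'
      have := H.S₁_pos.ne'
      rw [rho]; field_simp
    rw [h2]
    rcases sq_eq_one_iff.1 hε with h | h
    · rw [h, one_mul]; exact hρ.inv
    · rw [h, neg_one_mul]; exact hρ.inv.neg
  -- The line crosses `φ = 0` at height `d`. Full turns shift this height by elements of the
  -- subgroup generated by `ε 4 S₁` and `4 S₂`, dense by irrationality, so the height comes close to
  -- that of the umbilic point, `0`.
  obtain ⟨z, hz, hzd⟩ := (dense_addSubgroupClosure_pair_iff.2 hirr).exists_dist_lt (-d) hη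
  obtain ⟨n, m, rfl⟩ := AddSubgroup.mem_closure_pair.1 hz
  refine ⟨H.path ε d (H.lineLength ε d (0 + n * (2 * Real.pi))), ?_, mem_range_self _⟩
  rw [H.path_lineLength, H.lineV_add_two_pi _ _ (-m), param_add_two_pi, arcLength_lineV]
  have h3 := h1 (d + (ε * (n * (4 * S₁ a b c)) - ((-m : ℤ) : ℝ) * (4 * S₂ a b c))) (by
    rw [Real.dist_eq, abs_sub_comm] at hzd
    convert hzd using 2
    simp only [zsmul_eq_mul]; push_cast; ring)
  simpa [Nondegenerate.arcLength_zero] using h3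

/-- For a rational ratio every line, continued through umbilic points, is periodic. -/
lemma exists_periodic_path (hρ : ∃ q : ℚ, rho a b c = q) (hε : ε ^ 2 = 1) :
    ∃ T > 0, Function.Periodic (H.path ε d) T := by
  obtain ⟨q, hq⟩ := hρ
  have hS₁ := H.S₁_pos
  have hS₂ := H.S₂_pos
  have hqpos : 0 < q := by
    have : 0 < rho a b c := div_pos hS₂ hS₁
    rw [hq] at this
    exact_mod_cast this
  have hnum : 0 < q.num := Rat.num_pos.2 hqpos
  obtain ⟨e, rfl⟩ : ∃ e : ℤ, (e : ℝ) = ε := by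
    rcases sq_eq_one_iff.1 hε with h | h
    · exact ⟨1, by simp [h]⟩
    · exact ⟨-1, by simp [h]⟩
  have hrel : (q.num : ℝ) * S₁ a b c = q.den * S₂ a b c := by
    have hden : (q.den : ℝ) ≠ 0 := by exact_mod_cast q.den_ne_zero
    have h1 : (q.num : ℝ) / q.den = S₂ a b c / S₁ a b c := by
      rw [← rho, hq]; exact_mod_cast q.num_div_den
    field_simp at h1
    linear_combination h1
  -- For `ρ = num / den`, `num` turns of `φ` have the same `σ`-length as `den` turns of `ψ`, and the
  -- defect is zero.
  have hV : ∀ φ, H.lineV e d (φ + q.num * (2 * Real.pi)) =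
      H.lineV e d φ + (e * q.den : ℤ) * (2 * Real.pi) := by
    intro φ
    rw [H.lineV_add_two_pi φ q.num (e * q.den)]
    congr 1
    rw [OrderIso.symm_apply_eq, Nondegenerate.arcIso_apply]
    push_cast
    linear_combination 4 * (e : ℝ) * hrel
  set P := (q.num : ℝ) * (2 * Real.pi) with hP
  have hPpos : 0 < P := by
    have : (0 : ℝ) < q.num := by exact_mod_cast hnum
    positivity
  have hT : ∀ φ, H.lineTangent e d (φ + P) = H.lineTangent e d φ := by
    intro φ
    rw [lineTangent, lineTangent, slope, slope, hV, hP, paramU_add_two_pi, paramV_add_two_pi,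
      arcDensity_add_two_pi, arcDensity_add_two_pi]
  have hperT : Function.Periodic (fun φ => ‖H.lineTangent e d φ‖) P := fun φ => by
    simp only [hT]
  have hint : ∀ x y, IntervalIntegrable (fun φ => ‖H.lineTangent e d φ‖) MeasureTheory.volume x y :=
    fun x y => (H.continuous_lineTangent e d).norm.intervalIntegrable x y
  -- Periodicity in the angle passes to arclength, since the speed is periodic as well.
  have hL : ∀ φ, H.lineLength e d (φ + P) = H.lineLength e d φ + H.lineLength e d P := by
    intro φ
    have h1 := intervalIntegral.integral_add_adjacent_intervals (hint 0 φ) (hint φ (φ + P))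
    rw [hperT.intervalIntegral_add_eq φ 0, zero_add] at h1
    exact h1.symm
  refine ⟨H.lineLength e d P, ?_, fun s => ?_⟩
  · rw [← H.lineLength_zero e d]
    exact H.strictMono_lineLength e d hPpos
  · have h1 : s + H.lineLength e d P = H.lineLength e d (H.angleU e d s + P) := by
      rw [hL, H.lineLength_angleU]
    rw [h1, H.path_lineLength, hV, hP, param_add_two_pi]
    rfl

/-! ### Ends, recurrence and closedness of complete lines -/

section Complete

variable {J : Set ℝ} {γ : ℝ → E3} {τ : ℝ}

/-- A finite end is a boundary time outside the open set `J`, where `path` is still defined,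
continuous and at an umbilic point. -/
lemma isUmbilicSeparatrix_of_bddAbove (hγ : IsGMCLine (ellipsoid a b c) (inwardNormal a b c) J γ)
    (hpath : ∀ t ∈ J, γ t = H.path ε d (t + τ))
    (hend : ∀ t ∈ closure J, t ∉ J → H.pathGap ε d (t + τ) = 0) (hb : BddAbove J) :
    IsUmbilicSeparatrix (ellipsoid a b c) (inwardNormal a b c) J γ := by
  refine ⟨_, H.isUmbilic_path (hend _ (csSup_mem_closure hγ.nonempty hb)
    (csSup_notMem_of_isOpen hγ.isOpen hb)), Or.inl ?_⟩
  exact (((H.continuous_path ε d).tendsto _).comp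
    ((tendsto_coe_atTop_csSup hγ.nonempty hb).add_const τ)).congr fun t => (hpath t t.2).symm

lemma isUmbilicSeparatrix_of_bddBelow (hγ : IsGMCLine (ellipsoid a b c) (inwardNormal a b c) J γ)
    (hpath : ∀ t ∈ J, γ t = H.path ε d (t + τ))
    (hend : ∀ t ∈ closure J, t ∉ J → H.pathGap ε d (t + τ) = 0) (hb : BddBelow J) :
    IsUmbilicSeparatrix (ellipsoid a b c) (inwardNormal a b c) J γ := by
  refine ⟨_, H.isUmbilic_path (hend _ (csInf_mem_closure hγ.nonempty hb)
    (csInf_notMem_of_isOpen hγ.isOpen hb)), Or.inr ?_⟩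
  exact (((H.continuous_path ε d).tendsto _).comp
    ((tendsto_coe_atBot_csInf hγ.nonempty hb).add_const τ)).congr fun t => (hpath t t.2).symm

lemma isOmegaRecurrent (hε : ε ^ 2 = 1)
    (hγ : IsGMCLine (ellipsoid a b c) (inwardNormal a b c) J γ)
    (hpath : ∀ t ∈ J, γ t = H.path ε d (t + τ)) (hb : ¬ BddAbove J) : IsOmegaRecurrent J γ := by
  rintro _ ⟨t, ht, rfl⟩
  have h1 : MapClusterPt (γ t) atTop (fun t : J => H.path ε d (t + τ)) := by
    refine mapClusterPt_atTop (γ := fun t => H.path ε d (t + τ)) hγ.ordConnected hγ.nonempty hb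
      fun V hV M => ?_
    rw [hpath t ht] at hV
    obtain ⟨r, hr, hrV⟩ := H.path_returns_above hε _ hV (M + τ)
    exact ⟨r - τ, by linarith, by simpa using hrV⟩
  have h2 : (fun t : J => H.path ε d (t + τ)) = fun t : J => γ t :=
    funext fun t => (hpath t t.2).symm
  rwa [h2] at h1

lemma isAlphaRecurrent (hε : ε ^ 2 = 1)
    (hγ : IsGMCLine (ellipsoid a b c) (inwardNormal a b c) J γ)
    (hpath : ∀ t ∈ J, γ t = H.path ε d (t + τ)) (hb : ¬ BddBelow J) : IsAlphaRecurrent J γ := by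
  rintro _ ⟨t, ht, rfl⟩
  have h1 : MapClusterPt (γ t) atBot (fun t : J => H.path ε d (t + τ)) := by
    refine mapClusterPt_atBot (γ := fun t => H.path ε d (t + τ)) hγ.ordConnected hγ.nonempty hb
      fun V hV M => ?_
    rw [hpath t ht] at hV
    obtain ⟨r, hr, hrV⟩ := H.path_returns_below hε _ hV (M + τ)
    exact ⟨r - τ, by linarith, by simpa using hrV⟩
  have h2 : (fun t : J => H.path ε d (t + τ)) = fun t : J => γ t :=
    funext fun t => (hpath t t.2).symm
  rwa [h2] at h1

/-- A periodic line has compact image, equal to that of the whole `path`; it would contain the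
umbilic point at which `path` accumulates. -/
lemma not_isClosedLine (hρ : Irrational (rho a b c)) (hε : ε ^ 2 = 1)
    (hγ : IsGMCLine (ellipsoid a b c) (inwardNormal a b c) J γ)
    (hpath : ∀ t ∈ J, γ t = H.path ε d (t + τ)) : ¬ IsClosedLine J γ := by
  rintro ⟨rfl, T, hT, hper⟩
  have hrange : range γ = range (H.path ε d) := by
    ext x
    constructor
    · rintro ⟨t, rfl⟩; exact ⟨t + τ, (hpath t (mem_univ t)).symm⟩
    · rintro ⟨s, rfl⟩; exact ⟨s - τ, by rw [hpath _ (mem_univ _), sub_add_cancel]⟩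
  have hcont : Continuous γ := contDiffOn_univ.1 hγ.contDiffOn |>.continuous
  have hcl : IsClosed (range γ) := (hper.compact_of_continuous hT.ne' hcont).isClosed
  have h1 := H.umbilic_mem_closure_range_path (d := d) hρ hε
  rw [← hrange, hcl.closure_eq] at h1
  obtain ⟨t, ht⟩ := h1
  refine hγ.not_umbilic t (mem_univ t) (ht ▸ H.isUmbilic_param ?_)
  rw [H.gap_eq_zero_iff]; simp

end Complete

end Triaxial

end GeomMean

end

theorem proposition8 (a b c : ℝ) (hab : b < a) (hbc : c < b) (hc : 0 < c) :
    (Irrational (GeomMean.rho a b c) →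
      ∀ (J : Set ℝ) (γ : ℝ → GeomMean.E3),
        GeomMean.IsCompleteGMCLine (GeomMean.ellipsoid a b c) (GeomMean.inwardNormal a b c) J γ →
          GeomMean.IsRecurrent J γ ∧ ¬ GeomMean.IsClosedLine J γ ∧
          (¬ GeomMean.IsUmbilicSeparatrix (GeomMean.ellipsoid a b c)
              (GeomMean.inwardNormal a b c) J γ →
            GeomMean.IsOmegaRecurrent J γ ∧ GeomMean.IsAlphaRecurrent J γ)) ∧
    ((∃ q : ℚ, GeomMean.rho a b c = q) →
      ∀ (J : Set ℝ) (γ : ℝ → GeomMean.E3),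
        GeomMean.IsCompleteGMCLine (GeomMean.ellipsoid a b c) (GeomMean.inwardNormal a b c) J γ →
          (GeomMean.IsClosedLine J γ ↔
            ¬ GeomMean.IsUmbilicSeparatrix (GeomMean.ellipsoid a b c)
              (GeomMean.inwardNormal a b c) J γ)) := by
  have H : GeomMean.Triaxial a b c := ⟨hab, hbc, hc⟩
  constructor
  · intro hρ J γ hγ
    obtain ⟨ε, d, τ, hε, hpath, hend⟩ := H.exists_path_of_completeLine hγ
    have hL := hγ.isLine
    refine ⟨?_, H.not_isClosedLine hρ hε hL hpath, fun hsep => ?_⟩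
    · by_cases hT : BddAbove J
      · refine Or.inr (H.isAlphaRecurrent hε hL hpath fun hB => ?_)
        obtain ⟨t, ht⟩ := hL.nonempty
        -- If both ends were finite, both would be umbilic times of the same `path`, hence equal,
        -- and `J` would be empty.
        have h1 := H.pathGap_unique hρ hε
          (hend _ (csSup_mem_closure hL.nonempty hT) (GeomMean.csSup_notMem_of_isOpen hL.isOpen hT))
          (hend _ (csInf_mem_closure hL.nonempty hB) (GeomMean.csInf_notMem_of_isOpen hL.isOpen hB))
        have h2 : t = sSup J := by linarith [le_csSup hT ht, csInf_le hB ht]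
        exact GeomMean.csSup_notMem_of_isOpen hL.isOpen hT (h2 ▸ ht)
      · exact Or.inl (H.isOmegaRecurrent hε hL hpath hT)
    · exact ⟨H.isOmegaRecurrent hε hL hpath fun hb =>
          hsep (H.isUmbilicSeparatrix_of_bddAbove hL hpath hend hb),
        H.isAlphaRecurrent hε hL hpath fun hb =>
          hsep (H.isUmbilicSeparatrix_of_bddBelow hL hpath hend hb)⟩
  · intro hρ J γ hγ
    obtain ⟨ε, d, τ, hε, hpath, hend⟩ := H.exists_path_of_completeLine hγ
    have hL := hγ.isLine
    refine ⟨GeomMean.not_isUmbilicSeparatrix_of_isClosedLine hL, fun hsep => ?_⟩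
    -- A line with no umbilic end has no finite end, so it is a time shift of a whole periodic
    -- `path`.
    have hJ : J = Set.univ := GeomMean.eq_univ_of_unbounded hL.ordConnected
      (fun hb => hsep (H.isUmbilicSeparatrix_of_bddAbove hL hpath hend hb))
      (fun hb => hsep (H.isUmbilicSeparatrix_of_bddBelow hL hpath hend hb))
    obtain ⟨T, hT, hper⟩ := H.exists_periodic_path (d := d) hρ hε
    refine ⟨hJ, T, hT, fun t => ?_⟩
    rw [hpath _ (hJ ▸ Set.mem_univ _), hpath _ (hJ ▸ Set.mem_univ _), add_right_comm, hper]
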